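/- Let $A=(a_{ij})_{i,j\in I}$ be a symmetrizable generalized Cartan matrix with finite index set $I$, let $(\mathfrak h,\{\alpha_i\},\{\alpha_i^\vee\})$ be a (minimal) realization of $A$ over $\mathbb C$, and let $\mathfrak g=\mathfrak g(A)$ be the associated Kac–Moody algebra: the quotient of the Lie algebra $\tilde{\mathfrak g}(A)$, generated by $e_i,f_i$ $(i\in I)$ and the vector space $\mathfrak h$ with relations $[h,h']=0$, $[e_i,f_j]=\delta_{ij}\alpha_i^\vee$, $[h,e_i]=\alpha_i(h)e_i$, $[h,f_i]=-\alpha_i(h)f_i$, by its largest ideal that intersects $\mathfrak h$ trivially. For $\alpha\in\mathfrak h^*$ put $\mathfrak g_\alpha=\{x\in\mathfrak g:[h,x]=\alpha(h)x\ \forall h\in\mathfrak h\}$, let $\Delta=\{\alpha\in\mathfrak h^*\setminus\{0\}:\mathfrak g_\alpha\ne0\}$ be the set of roots and $\Delta^{\mathrm{re}}$ the set of real roots, i.e. of roots of the form $\alpha=w(\alpha_i)$ with $w$ in the Weyl group $W$ and $i\in I$. For such $\alpha$ put $\alpha^\vee=w(\alpha_i^\vee)$ (independent of the choice of $w,i$)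 and $s_\alpha(\beta)=\beta-\beta(\alpha^\vee)\alpha$. For $\alpha\in\Delta^{\mathrm{re}}$ and $\beta\in\Delta$, the $\alpha$-string through $\beta$ is $\mathbb S(\alpha,\beta)=\{\beta+k\alpha:k\in\mathbb Z\}\cap\Delta$. A regular subalgebra is a Lie subalgebra $\mathfrak s\subseteq\mathfrak g$ with $[\mathfrak h,\mathfrak s]\subseteq\mathfrak s$; put $\Delta(\mathfrak s)=\{\alpha\in\Delta:\mathfrak g_\alpha\cap\mathfrak s\neq0\}$ and $\Delta(\mathfrak s)^{\mathrm{re}}=\Delta(\mathfrak s)\cap\Delta^{\mathrm{re}}$. It is symmetric if $\Delta(\mathfrak s)=-\Delta(\mathfrak s)$. A non-empty subset $\Psi\subseteq\Delta$ is a subroot system if $s_\alpha(\beta)\in\Psi$ for all $\alpha\in\Psi\cap\Delta^{\mathrm{re}}$ and $\beta\in\Psi$; it is real closed if $\Psi\subseteq\Delta^{\mathrm{re}}$ and $\alpha+\beta\in\Psi$ whenever $\alpha,\beta\in\Psi$ and $\alpha+\beta\in\Delta^{\mathrm{re}}$. Let $\mathfrak s$ be a symmetric regular subalgebra of $\mathfrak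 g$ and let $\alpha,\beta\in\Delta(\mathfrak s)^{\mathrm{re}}$. Then: 1. if $\alpha+\beta\in\Delta$, then $\alpha+\beta\in\Delta(\mathfrak s)$; 2. $s_\alpha(\beta)\in\Delta(\mathfrak s)$; 3. $\mathbb S(\alpha,\beta)\subseteq\Delta(\mathfrak s)$. In particular, if $\Delta(\mathfrak s)^{\mathrm{re}}$ is non-empty, then it is a real closed subroot system of $\Delta$. -/

import Mathlib

/-- Generalized Cartan matrices. -/
structure IsGCM {I : Type*} (A : Matrix I I ℤ) : Prop where
  diag : ∀ i, A i i = 2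
  nonpos : ∀ i j, i ≠ j → A i j ≤ 0
  zero_symm : ∀ i j, A i j = 0 → A j i = 0

/-- `A` is symmetrizable: `D * A` is symmetric for some invertible diagonal matrix `D`. -/
def IsSymmetrizable {I : Type*} (A : Matrix I I ℤ) : Prop :=
  ∃ d : I → ℂ, (∀ i, d i ≠ 0) ∧ ∀ i j, d i * (A i j : ℂ) = d j * (A j i : ℂ)

/-- A (minimal) realization of `A`: linearly independent simple coroots in `𝔥` and simple roots in
the dual of `𝔥`, with `⟨αⱼ, αᵢ^∨⟩ = aᵢⱼ` and `dim 𝔥 = 2 n - rank A`. -/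
structure Realization {I : Type*} [Fintype I] (A : Matrix I I ℤ)
    (𝔥 : Type*) [AddCommGroup 𝔥] [Module ℂ 𝔥] where
  simpleCoroot : I → 𝔥
  simpleRoot : I → Module.Dual ℂ 𝔥
  linearIndependent_simpleCoroot : LinearIndependent ℂ simpleCoroot
  linearIndependent_simpleRoot : LinearIndependent ℂ simpleRoot
  simpleRoot_simpleCoroot : ∀ i j, simpleRoot j (simpleCoroot i) = (A i j : ℂ)
  finrank_add_rank :
    Module.finrank ℂ 𝔥 + (A.map (fun a : ℤ => (a : ℂ))).rank = 2 * Fintype.card I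

/-- The generators `eᵢ`, `fᵢ` and `h ∈ 𝔥`. -/
inductive KMGenerator (I 𝔥 : Type*)
  | e : I → KMGenerator I 𝔥
  | f : I → KMGenerator I 𝔥
  | h : 𝔥 → KMGenerator I 𝔥

namespace Realization

noncomputable section

variable {I : Type*} [Fintype I] {A : Matrix I I ℤ} {𝔥 : Type*} [AddCommGroup 𝔥] [Module ℂ 𝔥]

/-! ### The Kac-Moody algebra -/

/-- The free Lie algebra on the generators. -/
abbrev Free (_R : Realization A 𝔥) : Type _ := FreeLieAlgebra ℂ (KMGenerator I 𝔥)

/-- The generator `eᵢ` of the free Lie algebra. -/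
def freeE (R : Realization A 𝔥) (i : I) : R.Free := FreeLieAlgebra.of ℂ (KMGenerator.e i)

/-- The generator `fᵢ` of the free Lie algebra. -/
def freeF (R : Realization A 𝔥) (i : I) : R.Free := FreeLieAlgebra.of ℂ (KMGenerator.f i)

/-- The generator of the free Lie algebra that belongs to `x ∈ 𝔥`. -/
def freeH (R : Realization A 𝔥) (x : 𝔥) : R.Free := FreeLieAlgebra.of ℂ (KMGenerator.h x)

/-- The defining relations of the auxiliary algebra `𝔤̃(A)`. The first two say that `𝔥` is mapped
linearly into it. -/
inductive Relator (R : Realization A 𝔥) : R.Free → Prop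
  | add (x y : 𝔥) : Relator R (R.freeH (x + y) - (R.freeH x + R.freeH y))
  | smul (c : ℂ) (x : 𝔥) : Relator R (R.freeH (c • x) - c • R.freeH x)
  | hh (x y : 𝔥) : Relator R ⁅R.freeH x, R.freeH y⁆
  | ef_same (i : I) : Relator R (⁅R.freeE i, R.freeF i⁆ - R.freeH (R.simpleCoroot i))
  | ef_ne (i j : I) (hij : i ≠ j) : Relator R ⁅R.freeE i, R.freeF j⁆
  | he (x : 𝔥) (i : I) : Relator R (⁅R.freeH x, R.freeE i⁆ - R.simpleRoot i x • R.freeE i)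
  | hf (x : 𝔥) (i : I) : Relator R (⁅R.freeH x, R.freeF i⁆ + R.simpleRoot i x • R.freeF i)

/-- The ideal of the free Lie algebra generated by the relations. -/
def relationIdeal (R : Realization A 𝔥) : LieIdeal ℂ R.Free :=
  LieSubmodule.lieSpan ℂ R.Free {x | R.Relator x}

/-- The auxiliary Lie algebra `𝔤̃(A)`. -/
abbrev Tilde (R : Realization A 𝔥) : Type _ := R.Free ⧸ R.relationIdeal

/-- The canonical map from `𝔥` to `𝔤̃(A)`. -/
def tildeCartan (R : Realization A 𝔥) : 𝔥 →ₗ[ℂ] R.Tilde where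
  toFun x := LieSubmodule.Quotient.mk (R.freeH x)
  map_add' x y := (Submodule.Quotient.eq R.relationIdeal.toSubmodule).2
    (LieSubmodule.subset_lieSpan (Relator.add x y))
  map_smul' c x := (Submodule.Quotient.eq R.relationIdeal.toSubmodule).2
    (LieSubmodule.subset_lieSpan (Relator.smul c x))

/-- The largest ideal of `𝔤̃(A)` that intersects the image of `𝔥` trivially (the sum of all such
ideals). -/
def radical (R : Realization A 𝔥) : LieIdeal ℂ R.Tilde :=
  sSup {J : LieIdeal ℂ R.Tilde | J.toSubmodule ⊓ LinearMap.range R.tildeCartan = ⊥}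

/-- The Kac-Moody algebra `𝔤(A)`. -/
abbrev KacMoodyAlgebra (R : Realization A 𝔥) : Type _ := R.Tilde ⧸ R.radical

/-- The canonical map from `𝔥` to `𝔤(A)`. -/
def cartan (R : Realization A 𝔥) : 𝔥 →ₗ[ℂ] R.KacMoodyAlgebra :=
  R.radical.toSubmodule.mkQ ∘ₗ R.tildeCartan

/-! ### Roots -/

/-- `𝔤_α = {x ∈ 𝔤 | [h, x] = α(h) x for all h ∈ 𝔥}`. -/
def rootSpace (R : Realization A 𝔥) (α : Module.Dual ℂ 𝔥) : Submodule ℂ R.KacMoodyAlgebra where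
  carrier := {x | ∀ h : 𝔥, ⁅R.cartan h, x⁆ = α h • x}
  add_mem' {x y} hx hy h := by rw [lie_add, hx h, hy h, smul_add]
  zero_mem' h := by rw [lie_zero, smul_zero]
  smul_mem' c x hx h := by rw [lie_smul, hx h, smul_comm]

/-- The set of roots `Δ`. -/
def roots (R : Realization A 𝔥) : Set (Module.Dual ℂ 𝔥) :=
  {α | α ≠ 0 ∧ R.rootSpace α ≠ ⊥}

/-- The Weyl group as a subgroup of `GL(𝔥)`, generated by the simple reflections
`h ↦ h - αᵢ(h) αᵢ^∨`. -/
def weylGroup (R : Realization A 𝔥) : Subgroup (𝔥 ≃ₗ[ℂ] 𝔥) :=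
  Subgroup.closure {s | ∃ i, ∀ h, s h = h - R.simpleRoot i h • R.simpleCoroot i}

/-- `(w, i)` presents `α` as `w(αᵢ)`, for the contragredient action `w(λ) = λ ∘ w⁻¹` of the Weyl
group on the dual of `𝔥`. -/
def Presents (R : Realization A 𝔥) (α : Module.Dual ℂ 𝔥) (p : (𝔥 ≃ₗ[ℂ] 𝔥) × I) : Prop :=
  p.1 ∈ R.weylGroup ∧ α = R.simpleRoot p.2 ∘ₗ (p.1⁻¹ : 𝔥 ≃ₗ[ℂ] 𝔥).toLinearMap

/-- The real roots: the roots conjugate to a simple root under the Weyl group. -/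
def realRoots (R : Realization A 𝔥) : Set (Module.Dual ℂ 𝔥) :=
  {α | α ∈ R.roots ∧ ∃ p, R.Presents α p}

open Classical in
/-- The coroot `α^∨ = w(αᵢ^∨)` of a real root `α = w(αᵢ)`; see `coroot_eq` for its independence of
the presentation. -/
def coroot (R : Realization A 𝔥) (α : Module.Dual ℂ 𝔥) : 𝔥 :=
  if hα : ∃ p, R.Presents α p then hα.choose.1 (R.simpleCoroot hα.choose.2) else 0

/-- The reflection `s_α(β) = β - β(α^∨) α` in a real root `α`. -/
def reflection (R : Realization A 𝔥) (α β : Module.Dual ℂ 𝔥) : Module.Dual ℂ 𝔥 :=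
  β - β (R.coroot α) • α

/-- The `α`-string through `β`: all roots of the form `β + k α` with `k ∈ ℤ`. -/
def rootString (R : Realization A 𝔥) (α β : Module.Dual ℂ 𝔥) : Set (Module.Dual ℂ 𝔥) :=
  {γ | γ ∈ R.roots ∧ ∃ k : ℤ, γ = β + k • α}

/-- Subroot systems of `Δ`. -/
structure IsSubrootSystem (R : Realization A 𝔥) (Ψ : Set (Module.Dual ℂ 𝔥)) : Prop where
  nonempty : Ψ.Nonempty
  subset : Ψ ⊆ R.roots
  reflection_mem : ∀ α ∈ Ψ ∩ R.realRoots, ∀ β ∈ Ψ, R.reflection α β ∈ Ψ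

/-- Real closed subsets of `Δ`. -/
structure IsRealClosed (R : Realization A 𝔥) (Ψ : Set (Module.Dual ℂ 𝔥)) : Prop where
  nonempty : Ψ.Nonempty
  subset : Ψ ⊆ R.realRoots
  add_mem : ∀ α ∈ Ψ, ∀ β ∈ Ψ, α + β ∈ R.realRoots → α + β ∈ Ψ

/-! ### Regular subalgebras -/

/-- A regular subalgebra is an `𝔥`-invariant Lie subalgebra. -/
def IsRegular (R : Realization A 𝔥) (s : LieSubalgebra ℂ R.KacMoodyAlgebra) : Prop :=
  ∀ h : 𝔥, ∀ x ∈ s, ⁅R.cartan h, x⁆ ∈ s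

/-- `Δ(𝔰) = {α ∈ Δ | 𝔤_α ∩ 𝔰 ≠ 0}`. -/
def rootsOf (R : Realization A 𝔥) (s : LieSubalgebra ℂ R.KacMoodyAlgebra) :
    Set (Module.Dual ℂ 𝔥) :=
  {α | α ∈ R.roots ∧ R.rootSpace α ⊓ s.toSubmodule ≠ ⊥}

/-- `Δ(𝔰)^re`. -/
def realRootsOf (R : Realization A 𝔥) (s : LieSubalgebra ℂ R.KacMoodyAlgebra) :
    Set (Module.Dual ℂ 𝔥) :=
  R.realRoots ∩ R.rootsOf s

/-- `𝔰` is symmetric if `Δ(𝔰) = -Δ(𝔰)`. -/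
def IsSymmetric (R : Realization A 𝔥) (s : LieSubalgebra ℂ R.KacMoodyAlgebra) : Prop :=
  R.rootsOf s = {α | -α ∈ R.rootsOf s}

/-! ### The coroot of a real root does not depend on the presentation -/

/-- The graph of the map `αᵢ^∨ ↦ dᵢ⁻¹ αᵢ` on the span of the simple coroots. -/
def corootGraph (R : Realization A 𝔥) (d : I → ℂ) : Submodule ℂ (𝔥 × Module.Dual ℂ 𝔥) :=
  Submodule.span ℂ (Set.range fun i => (R.simpleCoroot i, (d i)⁻¹ • R.simpleRoot i))

theorem corootGraph_pairing (R : Realization A 𝔥) {d : I → ℂ} (hd : ∀ i, d i ≠ 0)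
    (hA : ∀ i j, d i * (A i j : ℂ) = d j * (A j i : ℂ)) {p : 𝔥 × Module.Dual ℂ 𝔥}
    (hp : p ∈ R.corootGraph d) (j : I) :
    p.2 (R.simpleCoroot j) = (d j)⁻¹ * R.simpleRoot j p.1 := by
  induction hp using Submodule.span_induction with
  | mem p hp =>
    obtain ⟨i, rfl⟩ := hp
    have h1 := hd i
    have h2 := hd j
    have h3 := hA i j
    simp only [LinearMap.smul_apply, simpleRoot_simpleCoroot, smul_eq_mul]
    field_simp
    linear_combination -h3
  | zero => simp
  | add x y _ _ hx hy => simp [hx, hy, mul_add]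
  | smul c x _ hx =>
    simp only [Prod.smul_snd, Prod.smul_fst, LinearMap.smul_apply, map_smul, hx, smul_eq_mul]
    ring

theorem corootGraph_weyl (R : Realization A 𝔥) (hdiag : ∀ i, A i i = 2) {d : I → ℂ}
    (hd : ∀ i, d i ≠ 0) (hA : ∀ i j, d i * (A i j : ℂ) = d j * (A j i : ℂ))
    {w : 𝔥 ≃ₗ[ℂ] 𝔥} (hw : w ∈ R.weylGroup) :
    ∀ p ∈ R.corootGraph d,
      (w p.1, p.2 ∘ₗ (w⁻¹ : 𝔥 ≃ₗ[ℂ] 𝔥).toLinearMap) ∈ R.corootGraph d := by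
  have key : ∀ (s t : 𝔥 ≃ₗ[ℂ] 𝔥) (i : I),
      (∀ h, s h = h - R.simpleRoot i h • R.simpleCoroot i) →
      (∀ h, t h = h - R.simpleRoot i h • R.simpleCoroot i) →
      ∀ p ∈ R.corootGraph d, (s p.1, p.2 ∘ₗ t.toLinearMap) ∈ R.corootGraph d := by
    intro s t i hs ht p hp
    have h1 : (s p.1, p.2 ∘ₗ t.toLinearMap) =
        p - R.simpleRoot i p.1 • (R.simpleCoroot i, (d i)⁻¹ • R.simpleRoot i) := by
      ext x
      · simp [hs]
      · simp only [LinearMap.comp_apply, LinearEquiv.coe_coe, ht, map_sub, map_smul, smul_eq_mul,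
          R.corootGraph_pairing hd hA hp, Prod.snd_sub, Prod.smul_snd, LinearMap.sub_apply,
          LinearMap.smul_apply]
        ring
    rw [h1]
    exact sub_mem hp (Submodule.smul_mem _ _ (Submodule.subset_span ⟨i, rfl⟩))
  have hinv : ∀ (s : 𝔥 ≃ₗ[ℂ] 𝔥) (i : I),
      (∀ h, s h = h - R.simpleRoot i h • R.simpleCoroot i) → s⁻¹ = s := by
    intro s i hs
    refine inv_eq_of_mul_eq_one_left ?_
    ext h
    simp only [LinearEquiv.mul_apply, hs, map_sub, map_smul, smul_eq_mul,
      simpleRoot_simpleCoroot, hdiag, LinearEquiv.coe_one, id]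
    module
  induction hw using Subgroup.closure_induction'' with
  | one => exact fun p hp => hp
  | mem s hs =>
    obtain ⟨i, hi⟩ := hs
    exact key s _ i hi (by rw [hinv s i hi]; exact hi)
  | inv_mem s hs =>
    obtain ⟨i, hi⟩ := hs
    rw [inv_inv]
    exact key _ s i (by rw [hinv s i hi]; exact hi) hi
  | mul x y _ _ hx hy =>
    intro p hp
    have := hx _ (hy p hp)
    rw [mul_inv_rev]
    exact this

theorem coroot_eq (R : Realization A 𝔥) (hA : IsGCM A) (hS : IsSymmetrizable A)
    {α : Module.Dual ℂ 𝔥} {p : (𝔥 ≃ₗ[ℂ] 𝔥) × I} (hp : R.Presents α p) :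
    R.coroot α = p.1 (R.simpleCoroot p.2) := by
  have hα : ∃ p, R.Presents α p := ⟨p, hp⟩
  rw [coroot, dif_pos hα]
  obtain ⟨hq1, hq2⟩ := hα.choose_spec
  obtain ⟨hp1, hp2⟩ := hp
  generalize hα.choose = q at hq1 hq2
  obtain ⟨d, hd, hd'⟩ := hS
  have mem : ∀ r : (𝔥 ≃ₗ[ℂ] 𝔥) × I, r.1 ∈ R.weylGroup →
      α = R.simpleRoot r.2 ∘ₗ (r.1⁻¹ : 𝔥 ≃ₗ[ℂ] 𝔥).toLinearMap →
      (d r.2 • r.1 (R.simpleCoroot r.2), α) ∈ R.corootGraph d := by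
    intro r hr hr'
    have h1 := R.corootGraph_weyl hA.diag hd hd' hr _
      (Submodule.smul_mem _ (d r.2) (Submodule.subset_span ⟨r.2, rfl⟩))
    convert h1 using 2
    · simp
    · rw [hr']
      simp [smul_smul, hd]
  have inj : ∀ x, (x, (0 : Module.Dual ℂ 𝔥)) ∈ R.corootGraph d → x = 0 := by
    intro x hx
    obtain ⟨c, hc⟩ := (Submodule.mem_span_range_iff_exists_fun ℂ).1 hx
    have h2 := congrArg Prod.snd hc
    have h1 := congrArg Prod.fst hc
    simp only [Prod.snd_sum, Prod.fst_sum, Prod.smul_mk, smul_smul] at h1 h2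
    have h3 := Fintype.linearIndependent_iff.1 R.linearIndependent_simpleRoot _ h2
    rw [← h1]
    refine Finset.sum_eq_zero fun i _ => ?_
    have := (mul_eq_zero.1 (h3 i)).resolve_right (inv_ne_zero (hd i))
    rw [this, zero_smul]
  have h0 := sub_mem (mem q hq1 hq2) (mem p hp1 hp2)
  rw [Prod.mk_sub_mk, sub_self] at h0
  have h1 := sub_eq_zero.1 (inj _ h0)
  have two : ∀ r : (𝔥 ≃ₗ[ℂ] 𝔥) × I,
      α = R.simpleRoot r.2 ∘ₗ (r.1⁻¹ : 𝔥 ≃ₗ[ℂ] 𝔥).toLinearMap →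
      α (r.1 (R.simpleCoroot r.2)) = 2 := by
    intro r hr
    have h2 : (r.1⁻¹ : 𝔥 ≃ₗ[ℂ] 𝔥) (r.1 (R.simpleCoroot r.2)) = R.simpleCoroot r.2 :=
      r.1.symm_apply_apply _
    rw [hr, LinearMap.comp_apply, LinearEquiv.coe_coe, h2, simpleRoot_simpleCoroot, hA.diag]
    norm_num
  have h2 := congrArg α h1
  rw [map_smul, map_smul, two q hq2, two p hp2, smul_eq_mul, smul_eq_mul] at h2
  have h3 : d q.2 = d p.2 := mul_right_cancel₀ two_ne_zero h2
  rw [h3] at h1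
  exact smul_right_injective 𝔥 (hd p.2) h1

end

end Realization

/-!
Let `α` be a real root of a symmetric subalgebra `𝔰`. Real root spaces are lines, so `𝔰` contains
`𝔤_α` and `𝔤_{-α}`, hence the elements `e`, `f` of an `𝔰𝔩₂`-triple for `α`. Such a triple exists
because each element `w` of the Weyl group lifts to an automorphism of `𝔤`, a product of
automorphisms `exp(ad eᵢ) exp(-ad fᵢ) exp(ad eᵢ)`, which carries the triple of a simple root to one
of `α`; this uses that `ad eᵢ` and `ad fᵢ` are locally nilpotent, i.e. the Serre relations, which
hold because the left hand sides are singular vectors and generate ideals of `𝔤̃` that miss `𝔥`.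

Now let `β` be another real root of `𝔰`, of weight `m = β(α^∨)`, and `k ≥ 0` with `β + kα` a root.
Then `eᵏ` does not vanish on the line `𝔤_β ⊆ 𝔰`, so that `β + kα` is a root of `𝔰`. If `m + k ≤ 0`,
this is because `fᵏ eᵏ` is injective on vectors of weight `m`. If `m + k ≥ 0`, then `eᵏ fᵏ` is
injective on `𝔤_{β + kα}`, whose image under `fᵏ` lies in `𝔤_β`. Negative `k` are handled by `-α`.
-/

open LieAlgebra Module

/-! ### Locally nilpotent endomorphisms and their exponentials -/

section LocallyNilpotent

open Finset.HasAntidiagonal (antidiagonal mem_antidiagonal)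
open scoped Nat

/-- Local nilpotency of an endomorphism `D`: every vector is killed by some power of `D`. -/
def IsLocallyNilpotent {K M : Type*} [Semiring K] [AddCommMonoid M] [Module K M]
    (D : End K M) : Prop :=
  ∀ y, ∃ n, (D ^ n) y = 0

namespace IsLocallyNilpotent

section Ring

variable {K M : Type*} [CommRing K] [AddCommGroup M] [Module K M] {D : End K M}

theorem exists_forall_pow_apply_eq_zero (hD : IsLocallyNilpotent D) (y : M) :
    ∃ N, ∀ n, N ≤ n → (D ^ n) y = 0 :=
  let ⟨N, hN⟩ := hD y
  ⟨N, fun _ hn => End.pow_map_zero_of_le hn hN⟩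

theorem smul (hD : IsLocallyNilpotent D) (c : K) : IsLocallyNilpotent (c • D) := fun y =>
  let ⟨n, hn⟩ := hD y
  ⟨n, by rw [smul_pow, LinearMap.smul_apply, hn, smul_zero]⟩

theorem neg (hD : IsLocallyNilpotent D) : IsLocallyNilpotent (-D) := by
  simpa only [neg_one_smul] using hD.smul (-1)

theorem conj {N : Type*} [AddCommGroup N] [Module K N] (hD : IsLocallyNilpotent D)
    (e : M ≃ₗ[K] N) : IsLocallyNilpotent (e.conj D) := fun y =>
  let ⟨n, hn⟩ := hD (e.symm y)
  have conj_pow : e.conj D ^ n = e.conj (D ^ n) := (map_pow e.conjRingEquiv D n).symm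
  ⟨n, by rw [conj_pow, LinearEquiv.conj_apply_apply, hn, map_zero]⟩

theorem ad_iff_engel_eq_top {L : Type*} [LieRing L] [LieAlgebra K L] {x : L} :
    IsLocallyNilpotent (ad K L x) ↔ LieSubalgebra.engel K x = ⊤ := by
  simp only [SetLike.ext_iff, LieSubalgebra.mem_engel_iff, LieSubalgebra.mem_top, iff_true,
    IsLocallyNilpotent]

theorem ad_lieEquiv {L L' : Type*} [LieRing L] [LieAlgebra K L] [LieRing L'] [LieAlgebra K L']
    (e : L ≃ₗ⁅K⁆ L') {x : L} (hx : IsLocallyNilpotent (ad K L x)) :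
    IsLocallyNilpotent (ad K L' (e x)) := by
  rw [← conj_ad_apply]
  exact hx.conj e.toLinearEquiv

end Ring

theorem exists_pow_apply_ne_zero {K M : Type*} [Semiring K] [AddCommMonoid M] [Module K M]
    {D : End K M} (hD : IsLocallyNilpotent D) {y : M} (hy : y ≠ 0) :
    ∃ n, (D ^ n) y ≠ 0 ∧ D ((D ^ n) y) = 0 := by
  classical
  obtain ⟨n, hn⟩ : ∃ n, Nat.find (hD y) = n + 1 :=
    Nat.exists_eq_succ_of_ne_zero fun h => hy <| by simpa [h] using Nat.find_spec (hD y)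
  refine ⟨n, Nat.find_min (hD y) (by lia), ?_⟩
  rw [← End.mul_apply, ← pow_succ', ← hn]
  exact Nat.find_spec (hD y)

section Exponential

variable {K M : Type*} [Field K] [AddCommGroup M] [Module K M] {D : End K M}

theorem hasFiniteSupport (hD : IsLocallyNilpotent D) (y : M) :
    (fun n : ℕ => ((n ! : K))⁻¹ • (D ^ n) y).HasFiniteSupport := by
  obtain ⟨N, hN⟩ := hD.exists_forall_pow_apply_eq_zero y
  refine (Set.finite_lt_nat N).subset fun n hn => ?_
  contrapose! hn
  simp [hN n (le_of_not_gt hn)]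

/-- The exponential `∑ Dⁿ / n!` of a locally nilpotent endomorphism. In characteristic `p > 0` the
terms with `n ≥ p` are `0` by the convention `0⁻¹ = 0`. -/
noncomputable def exp (hD : IsLocallyNilpotent D) : End K M where
  toFun y := ∑ᶠ n : ℕ, ((n ! : K))⁻¹ • (D ^ n) y
  map_add' y z := by
    simp only [map_add, smul_add]
    exact finsum_add_distrib (hD.hasFiniteSupport y) (hD.hasFiniteSupport z)
  map_smul' c y := by
    simp only [map_smul, smul_comm _ c, RingHom.id_apply]
    exact (smul_finsum c _).symm

theorem exp_apply_eq_sum (hD : IsLocallyNilpotent D) {y : M} {N : ℕ}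
    (hN : ∀ n, N ≤ n → (D ^ n) y = 0) :
    hD.exp y = ∑ n ∈ Finset.range N, ((n ! : K))⁻¹ • (D ^ n) y := by
  refine finsum_eq_sum_of_support_subset _ fun n hn => ?_
  contrapose! hn
  simp only [Finset.coe_range, Set.mem_Iio, not_lt] at hn
  simp [hN n hn]

theorem exp_apply_of_apply_eq_zero (hD : IsLocallyNilpotent D) {y : M} (hy : D y = 0) :
    hD.exp y = y := by
  rw [hD.exp_apply_eq_sum (N := 1) fun n hn => End.pow_map_zero_of_le hn (by simpa using hy)]
  simp

theorem exp_apply_of_sq_apply_eq_zero (hD : IsLocallyNilpotent D) {y : M} (hy : D (D y) = 0) :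
    hD.exp y = y + D y := by
  rw [hD.exp_apply_eq_sum (N := 2) fun n hn =>
    End.pow_map_zero_of_le hn (by simpa [pow_succ] using hy)]
  simp [Finset.sum_range_succ]

theorem exp_apply_of_cube_apply_eq_zero (hD : IsLocallyNilpotent D) {y : M}
    (hy : D (D (D y)) = 0) : hD.exp y = y + D y + (2 : K)⁻¹ • D (D y) := by
  rw [hD.exp_apply_eq_sum (N := 3) fun n hn =>
    End.pow_map_zero_of_le hn (by simpa [pow_succ] using hy)]
  simp [Finset.sum_range_succ, pow_succ, Nat.factorial]

theorem commute_exp (hD : IsLocallyNilpotent D) : Commute D hD.exp := by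
  refine LinearMap.ext fun y => ?_
  change D (∑ᶠ n : ℕ, ((n ! : K))⁻¹ • (D ^ n) y) = ∑ᶠ n : ℕ, ((n ! : K))⁻¹ • (D ^ n) (D y)
  rw [← LinearMap.toAddMonoidHom_coe, AddMonoidHom.map_finsum _ (hD.hasFiniteSupport y)]
  refine finsum_congr fun n => ?_
  rw [LinearMap.toAddMonoidHom_coe, map_smul, ← End.mul_apply, ← End.mul_apply,
    (Commute.self_pow D n).eq]

theorem pow_apply_exp (hD : IsLocallyNilpotent D) (n : ℕ) (y : M) :
    (D ^ n) (hD.exp y) = hD.exp ((D ^ n) y) :=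
  LinearMap.congr_fun (hD.commute_exp.pow_left n).eq y

theorem exp_injective (hD : IsLocallyNilpotent D) : Function.Injective hD.exp := by
  rw [injective_iff_map_eq_zero]
  intro y hy
  obtain ⟨n, hn⟩ := hD y
  induction n with
  | zero => exact hn
  | succ n ih =>
    refine ih ?_
    rw [← hD.exp_apply_of_apply_eq_zero (y := (D ^ n) y) (by rwa [pow_succ'] at hn),
      ← hD.pow_apply_exp, hy, map_zero]

theorem exp_surjective (hD : IsLocallyNilpotent D) : Function.Surjective hD.exp := by
  intro y
  obtain ⟨n, hn⟩ := hD y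
  induction n generalizing y with
  | zero => exact ⟨0, by rw [map_zero]; exact hn.symm⟩
  | succ n ih =>
    obtain ⟨z, hz⟩ := ih (hD.exp y - y) <| by
      rw [map_sub, hD.pow_apply_exp,
        hD.exp_apply_of_apply_eq_zero (y := (D ^ n) y) (by rwa [pow_succ'] at hn), sub_self]
    exact ⟨y - z, by rw [map_sub, hz, sub_sub_cancel]⟩

end Exponential

end IsLocallyNilpotent

theorem sum_range_antidiagonal_eq_sum_product {M : Type*} [AddCommMonoid M] {g : ℕ × ℕ → M}
    {a b : ℕ} (hg : ∀ p, g p ≠ 0 → p.1 < a ∧ p.2 < b) :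
    ∑ n ∈ Finset.range (a + b), ∑ p ∈ antidiagonal n, g p =
      ∑ p ∈ Finset.range a ×ˢ Finset.range b, g p := by
  rw [← Finset.sum_fiberwise_of_maps_to (g := fun p : ℕ × ℕ => p.1 + p.2)
    (t := Finset.range (a + b)) fun p hp => by
      simp only [Finset.mem_product, Finset.mem_range] at hp ⊢
      lia]
  refine Finset.sum_congr rfl fun n _ =>
    (Finset.sum_subset (fun p hp => ?_) fun p hp hp' => ?_).symm
  · exact mem_antidiagonal.2 (Finset.mem_filter.1 hp).2
  · contrapose! hp'
    simpa [hg p hp'] using hp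

section ExpAd

variable {K L M : Type*} [Field K] [CharZero K] [LieRing L] [LieAlgebra K L]

theorem inv_factorial_smul_toEnd_pow_lie [AddCommGroup M] [Module K M] [LieRingModule L M]
    [LieModule K L M] (x y : L) (m : M) (n : ℕ) :
    ((n ! : K))⁻¹ • (LieModule.toEnd K L M x ^ n) ⁅y, m⁆ = ∑ p ∈ antidiagonal n,
      ⁅((p.1 ! : K))⁻¹ • (ad K L x ^ p.1) y,
        ((p.2 ! : K))⁻¹ • (LieModule.toEnd K L M x ^ p.2) m⁆ := by
  rw [LieModule.toEnd_pow_lie, Finset.smul_sum]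
  refine Finset.sum_congr rfl fun p hp => ?_
  rw [smul_lie, lie_smul, smul_smul, ← Nat.cast_smul_eq_nsmul K, smul_smul]
  congr 1
  obtain rfl := mem_antidiagonal.1 hp
  have hchoose : ((p.1 + p.2).choose p.1 : K) * p.1 ! * p.2 ! = (p.1 + p.2)! := by
    rw [Nat.choose_symm_add]
    exact_mod_cast Nat.add_choose_mul_factorial_mul_factorial p.1 p.2
  have hne (k : ℕ) : (k ! : K) ≠ 0 := by exact_mod_cast k.factorial_ne_zero
  field_simp [hne]
  linear_combination hchoose

theorem IsLocallyNilpotent.exp_toEnd_lie [AddCommGroup M] [Module K M] [LieRingModule L M]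
    [LieModule K L M] {x : L} (hL : IsLocallyNilpotent (ad K L x))
    (hM : IsLocallyNilpotent (LieModule.toEnd K L M x)) (y : L) (m : M) :
    hM.exp ⁅y, m⁆ = ⁅hL.exp y, hM.exp m⁆ := by
  obtain ⟨a, ha⟩ := hL.exists_forall_pow_apply_eq_zero y
  obtain ⟨b, hb⟩ := hM.exists_forall_pow_apply_eq_zero m
  set g : ℕ × ℕ → M := fun p =>
    ⁅((p.1 ! : K))⁻¹ • (ad K L x ^ p.1) y, ((p.2 ! : K))⁻¹ • (LieModule.toEnd K L M x ^ p.2) m⁆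
  have hg : ∀ p, g p ≠ 0 → p.1 < a ∧ p.2 < b := by
    intro p hp
    contrapose! hp
    rcases lt_or_ge p.1 a with h | h
    · simp [g, hb p.2 (hp h)]
    · simp [g, ha p.1 h]
  have hterm := inv_factorial_smul_toEnd_pow_lie (K := K) x y m
  have hyz : ∀ n, a + b ≤ n → (LieModule.toEnd K L M x ^ n) ⁅y, m⁆ = 0 := by
    intro n hn
    rw [LieModule.toEnd_pow_lie]
    refine Finset.sum_eq_zero fun p hp => ?_
    rw [mem_antidiagonal] at hp
    rcases (by lia : a ≤ p.1 ∨ b ≤ p.2) with h | h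
    · rw [ha _ h, zero_lie, smul_zero]
    · rw [hb _ h, lie_zero, smul_zero]
  rw [hM.exp_apply_eq_sum hyz, hL.exp_apply_eq_sum ha, hM.exp_apply_eq_sum hb,
    sum_lie_sum, ← Finset.sum_product', ← sum_range_antidiagonal_eq_sum_product hg]
  exact Finset.sum_congr rfl fun n _ => hterm n

/-- The exponential of `ad x` for a locally ad-nilpotent element `x`. -/
noncomputable def expAd (x : L) (hx : IsLocallyNilpotent (ad K L x)) : L ≃ₗ⁅K⁆ L :=
  LieEquiv.ofBijective
    { hx.exp with map_lie' := hx.exp_toEnd_lie hx _ _ }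
    ⟨hx.exp_injective, hx.exp_surjective⟩

end ExpAd

end LocallyNilpotent

/-! ### Integrable representations of `𝔰𝔩₂` -/

section Sl2

open LieModule (toEnd)

variable {K L M : Type*} [Field K] [LieRing L] [LieAlgebra K L] [AddCommGroup M] [Module K M]
  [LieRingModule L M] [LieModule K L M] {h e f : L}

namespace Sl2Rep

theorem lie_h_lie_e (t : IsSl2Triple h e f) {y : M} {μ : K} (hy : ⁅h, y⁆ = μ • y) :
    ⁅h, ⁅e, y⁆⁆ = (μ + 2) • ⁅e, y⁆ := by
  rw [leibniz_lie, t.lie_h_e_smul K, hy, smul_lie, lie_smul]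
  module

theorem lie_h_lie_f (t : IsSl2Triple h e f) {y : M} {μ : K} (hy : ⁅h, y⁆ = μ • y) :
    ⁅h, ⁅f, y⁆⁆ = (μ - 2) • ⁅f, y⁆ := by
  rw [leibniz_lie, t.lie_lie_smul_f K, hy, neg_lie, smul_lie, lie_smul]
  module

theorem lie_h_pow_e (t : IsSl2Triple h e f) {y : M} {μ : K} (hy : ⁅h, y⁆ = μ • y) (k : ℕ) :
    ⁅h, (toEnd K L M e ^ k) y⁆ = (μ + 2 * k) • (toEnd K L M e ^ k) y := by
  induction k with
  | zero => simpa using hy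
  | succ k ih =>
    rw [pow_succ', End.mul_apply, LieModule.toEnd_apply_apply, lie_h_lie_e t ih]
    congr 1
    push_cast
    ring

theorem lie_h_pow_f (t : IsSl2Triple h e f) {y : M} {μ : K} (hy : ⁅h, y⁆ = μ • y) (k : ℕ) :
    ⁅h, (toEnd K L M f ^ k) y⁆ = (μ - 2 * k) • (toEnd K L M f ^ k) y := by
  have hneg := lie_h_pow_e t.symm (y := y) (μ := -μ) (by rw [neg_lie, hy, neg_smul]) k
  rw [neg_lie, neg_eq_iff_eq_neg] at hneg
  rw [hneg]
  module

theorem lie_e_pow_succ_f (t : IsSl2Triple h e f) {y : M} {μ : K} (hy : ⁅h, y⁆ = μ • y) (k : ℕ) :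
    ⁅e, (toEnd K L M f ^ (k + 1)) y⁆ =
      (toEnd K L M f ^ k) (⁅e, ⁅f, y⁆⁆ - ((k : K) * (k + 1 - μ)) • y) := by
  induction k with
  | zero => simp
  | succ k ih =>
    have push (z : M) : ⁅f, (toEnd K L M f ^ k) z⁆ = (toEnd K L M f ^ (k + 1)) z := by
      rw [pow_succ', End.mul_apply, LieModule.toEnd_apply_apply]
    rw [pow_succ', End.mul_apply, LieModule.toEnd_apply_apply, leibniz_lie, t.lie_e_f, ih,
      lie_h_pow_f t hy, push, map_sub, map_sub, map_smul, map_smul]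
    push_cast
    module

variable [CharZero K]

/-- The value `j (j + 1 - m)` is the one that the ladder relation produces for `e fʲ⁺¹ y = 0`; as
`j < m`, the powers `eⁿ y` can then never reach zero. -/
theorem eq_zero_of_lie_e_lie_f_eq (t : IsSl2Triple h e f) (he : IsLocallyNilpotent (toEnd K L M e))
    {y : M} {m j : ℕ} (hy : ⁅h, y⁆ = (m : K) • y) (hj : j < m)
    (hef : ⁅e, ⁅f, y⁆⁆ = ((j : K) * (j + 1 - m)) • y) : y = 0 := by
  by_contra hy0
  obtain ⟨n, hn, hn'⟩ := he.exists_pow_apply_ne_zero hy0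
  have hfe : ⁅f, ⁅e, y⁆⁆ = ((j : K) * (j + 1 - m) - m) • y := by
    rw [sub_smul, ← hef, ← hy, ← t.lie_e_f, lie_lie, sub_sub_cancel]
  have hladder := lie_e_pow_succ_f t.symm (y := y) (μ := -(m : K))
    (by rw [neg_lie, hy, neg_smul]) n
  rw [pow_succ', End.mul_apply, hn', lie_zero, hfe, ← sub_smul, map_smul] at hladder
  have hcoeff : (j : K) * (j + 1 - m) - m - n * (n + 1 - -m) =
      -(((j + 1 + n : ℕ) : K) * ((n + m - j : ℤ) : K)) := by
    push_cast
    ring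
  rw [hcoeff, eq_comm, smul_eq_zero_iff_left hn, neg_eq_zero, mul_eq_zero, Nat.cast_eq_zero,
    Int.cast_eq_zero] at hladder
  lia

theorem eq_zero_of_pow_e_pow_f_eq_zero (t : IsSl2Triple h e f)
    (he : IsLocallyNilpotent (toEnd K L M e)) {y : M} {m k : ℕ} (hkm : k ≤ m)
    (hy : ⁅h, y⁆ = (m : K) • y) (h0 : (toEnd K L M e ^ k) ((toEnd K L M f ^ k) y) = 0) :
    y = 0 := by
  induction k generalizing y with
  | zero => simpa using h0
  | succ k ih =>
    rw [pow_succ, End.mul_apply, LieModule.toEnd_apply_apply, lie_e_pow_succ_f t hy] at h0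
    refine eq_zero_of_lie_e_lie_f_eq t he hy hkm (sub_eq_zero.1 (ih (by lia) ?_ h0))
    rw [lie_sub, lie_smul, hy, lie_h_lie_e t (lie_h_lie_f t hy)]
    module

theorem exists_intCast_eq_weight (t : IsSl2Triple h e f) (he : IsLocallyNilpotent (toEnd K L M e))
    (hf : IsLocallyNilpotent (toEnd K L M f)) {y : M} (hy0 : y ≠ 0) {μ : K}
    (hy : ⁅h, y⁆ = μ • y) : ∃ m : ℤ, μ = m := by
  obtain ⟨n, hn, hn'⟩ := he.exists_pow_apply_ne_zero hy0
  have primitive : t.HasPrimitiveVectorWith ((toEnd K L M e ^ n) y) (μ + 2 * n) :=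
    ⟨hn, lie_h_pow_e t hy n, hn'⟩
  obtain ⟨k, hk, hk'⟩ := hf.exists_pow_apply_ne_zero hn
  have hlie := primitive.lie_e_pow_succ_toEnd_f k
  rw [pow_succ', End.mul_apply, hk', lie_zero, eq_comm, smul_eq_zero_iff_left hk, mul_eq_zero,
    or_iff_right (by exact_mod_cast k.succ_ne_zero), sub_eq_zero] at hlie
  exact ⟨k - 2 * n, by push_cast; linear_combination hlie⟩

theorem pow_e_ne_zero_of_add_nonpos (t : IsSl2Triple h e f)
    (hf : IsLocallyNilpotent (toEnd K L M f)) {x : M} (hx0 : x ≠ 0) {m : ℤ} {k : ℕ}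
    (hx : ⁅h, x⁆ = (m : K) • x) (hmk : m + k ≤ 0) : (toEnd K L M e ^ k) x ≠ 0 := by
  obtain ⟨n, hn⟩ := Int.eq_ofNat_of_zero_le (by lia : 0 ≤ -m)
  refine fun h0 => hx0 (eq_zero_of_pow_e_pow_f_eq_zero t.symm hf (m := n) (k := k) (by lia) ?_ ?_)
  · rw [neg_lie, hx, ← neg_smul, ← Int.cast_neg, hn, Int.cast_natCast]
  · rw [h0, map_zero]

theorem pow_e_ne_zero_of_pow_f_mem_span (t : IsSl2Triple h e f)
    (he : IsLocallyNilpotent (toEnd K L M e)) {x y : M} (hy0 : y ≠ 0) {m : ℤ} {k : ℕ}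
    (hy : ⁅h, y⁆ = ((m + 2 * k : ℤ) : K) • y) (hmk : 0 ≤ m + k)
    (hyx : (toEnd K L M f ^ k) y ∈ Submodule.span K {x}) : (toEnd K L M e ^ k) x ≠ 0 := by
  obtain ⟨c, hc⟩ := Submodule.mem_span_singleton.1 hyx
  obtain ⟨n, hn⟩ := Int.eq_ofNat_of_zero_le (by lia : 0 ≤ m + 2 * k)
  refine fun h0 => hy0 (eq_zero_of_pow_e_pow_f_eq_zero t he (m := n) (k := k) (by lia) ?_ ?_)
  · rw [hy, hn, Int.cast_natCast]
  · rw [← hc, map_smul, h0, smul_zero]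

end Sl2Rep

end Sl2

/-! ### Free Lie algebras and quotients -/

theorem lieSpan_range_freeLieAlgebra_of (K X : Type*) [CommRing K] :
    LieSubalgebra.lieSpan K (FreeLieAlgebra K X) (Set.range (FreeLieAlgebra.of K)) = ⊤ := by
  let S := LieSubalgebra.lieSpan K (FreeLieAlgebra K X) (Set.range (FreeLieAlgebra.of K))
  let ψ : FreeLieAlgebra K X →ₗ⁅K⁆ S :=
    FreeLieAlgebra.lift K fun x => ⟨FreeLieAlgebra.of K x, LieSubalgebra.subset_lieSpan ⟨x, rfl⟩⟩
  have incl_comp : S.incl.comp ψ = LieHom.id := FreeLieAlgebra.hom_ext fun x =>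
    congrArg Subtype.val (FreeLieAlgebra.lift_of_apply _ x)
  refine eq_top_iff.2 fun y _ => ?_
  have coe_apply : (ψ y : FreeLieAlgebra K X) = y := DFunLike.congr_fun incl_comp y
  exact coe_apply ▸ (ψ y).2

/-- The quotient map by a Lie ideal as a homomorphism of Lie algebras;
`LieSubmodule.Quotient.mk'` is only a homomorphism of modules. -/
def lieQuotientMk {K L : Type*} [CommRing K] [LieRing L] [LieAlgebra K L] (J : LieIdeal K L) :
    L →ₗ⁅K⁆ L ⧸ J :=
  { (LieSubmodule.Quotient.mk' J : L →ₗ[K] L ⧸ J) with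
    map_lie' := fun {x y} => LieSubmodule.Quotient.mk_bracket J x y }

theorem lieQuotientMk_surjective {K L : Type*} [CommRing K] [LieRing L] [LieAlgebra K L]
    (J : LieIdeal K L) : Function.Surjective (lieQuotientMk J) :=
  LieSubmodule.Quotient.surjective_mk' J

theorem lieQuotientMk_eq_zero {K L : Type*} [CommRing K] [LieRing L] [LieAlgebra K L]
    {J : LieIdeal K L} {x : L} (hx : x ∈ J) : lieQuotientMk J x = 0 :=
  LieSubmodule.Quotient.mk_eq_zero'.2 hx

theorem map_ad_pow {K L L' : Type*} [CommRing K] [LieRing L] [LieAlgebra K L] [LieRing L']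
    [LieAlgebra K L'] (φ : L →ₗ⁅K⁆ L') (x y : L) (n : ℕ) :
    φ ((ad K L x ^ n) y) = (ad K L' (φ x) ^ n) (φ y) := by
  have comm : (φ : L →ₗ[K] L') ∘ₗ ad K L x = ad K L' (φ x) ∘ₗ (φ : L →ₗ[K] L') :=
    LinearMap.ext fun z => φ.map_lie x z
  exact (LinearMap.congr_fun (End.commute_pow_left_of_commute comm.symm n) y).symm

/-! ### Spans and gradings in a Lie algebra -/

section LieSpan

variable {K L M : Type*} [CommRing K] [LieRing L] [LieAlgebra K L]

theorem lie_mem_of_mem_lieSpan_left [AddCommGroup M] [Module K M] [LieRingModule L M]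
    [LieModule K L M] {s : Set L} {U : Submodule K M} (hU : ∀ a ∈ s, ∀ u ∈ U, ⁅a, u⁆ ∈ U) {x : L}
    (hx : x ∈ LieSubalgebra.lieSpan K L s) {u : M} (hu : u ∈ U) : ⁅x, u⁆ ∈ U := by
  induction hx using LieSubalgebra.lieSpan_induction generalizing u with
  | mem a ha => exact hU a ha u hu
  | zero => rw [zero_lie]; exact zero_mem U
  | add a b _ _ ha hb => rw [add_lie]; exact add_mem (ha hu) (hb hu)
  | smul c a _ ha => rw [smul_lie]; exact U.smul_mem c (ha hu)
  | lie a b _ _ ha hb => rw [lie_lie]; exact sub_mem (ha (hb hu)) (hb (ha hu))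

theorem lie_mem_of_mem_lieSpan_right {s : Set L} {V : Submodule K L}
    (hV : ∀ a ∈ s, ∀ v ∈ V, ⁅a, v⁆ ∈ V) {z : L} (hz : ∀ a ∈ s, ⁅z, a⁆ ∈ V) {x : L}
    (hx : x ∈ LieSubalgebra.lieSpan K L s) : ⁅z, x⁆ ∈ V := by
  induction hx using LieSubalgebra.lieSpan_induction with
  | mem a ha => exact hz a ha
  | zero => rw [lie_zero]; exact zero_mem V
  | add a b _ _ ha hb => rw [lie_add]; exact add_mem ha hb
  | smul c a _ ha => rw [lie_smul]; exact V.smul_mem c ha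
  | lie a b ha' hb' ha hb =>
    rw [leibniz_lie, ← lie_skew]
    exact add_mem (neg_mem (lie_mem_of_mem_lieSpan_left hV hb' ha))
      (lie_mem_of_mem_lieSpan_left hV ha' hb)

variable (K) in
/-- The sum of the eigenspaces of `ad d` for the integral eigenvalues in `S`. -/
def degreeSum (d : L) (S : Set ℤ) : Submodule K L :=
  Submodule.span K {x | ∃ n ∈ S, ⁅d, x⁆ = (n : K) • x}

theorem mem_degreeSum {d x : L} {S : Set ℤ} {n : ℤ} (hn : n ∈ S) (hx : ⁅d, x⁆ = (n : K) • x) :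
    x ∈ degreeSum K d S :=
  Submodule.subset_span ⟨n, hn, hx⟩

theorem degreeSum_mono {d : L} {S T : Set ℤ} (h : S ⊆ T) : degreeSum K d S ≤ degreeSum K d T :=
  Submodule.span_mono fun _ ⟨n, hn, hx⟩ => ⟨n, h hn, hx⟩

theorem lie_mem_degreeSum {d x y : L} {S T U : Set ℤ} (h : ∀ m ∈ S, ∀ n ∈ T, m + n ∈ U)
    (hx : x ∈ degreeSum K d S) (hy : y ∈ degreeSum K d T) : ⁅x, y⁆ ∈ degreeSum K d U := by
  induction hx, hy using Submodule.span_induction₂ with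
  | mem_mem x y hx hy =>
    obtain ⟨m, hm, hx⟩ := hx
    obtain ⟨n, hn, hy⟩ := hy
    refine mem_degreeSum (h m hm n hn) ?_
    rw [leibniz_lie, hx, hy, smul_lie, lie_smul, Int.cast_add, add_smul]
  | zero_left y _ => rw [zero_lie]; exact zero_mem _
  | zero_right x _ => rw [lie_zero]; exact zero_mem _
  | add_left x y z _ _ _ hx hy => rw [add_lie]; exact add_mem hx hy
  | add_right x y z _ _ _ hx hy => rw [lie_add]; exact add_mem hx hy
  | smul_left c x y _ _ hxy => rw [smul_lie]; exact Submodule.smul_mem _ c hxy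
  | smul_right c x y _ _ hxy => rw [lie_smul]; exact Submodule.smul_mem _ c hxy

theorem lieSpan_le_degreeSum {d : L} {s : Set L} {S : Set ℤ}
    (hS : ∀ m ∈ S, ∀ n ∈ S, m + n ∈ S) (hs : s ⊆ degreeSum K d S) :
    (LieSubalgebra.lieSpan K L s).toSubmodule ≤ degreeSum K d S :=
  LieSubalgebra.lieSpan_le (K := { degreeSum K d S with lie_mem' := lie_mem_degreeSum hS }).2 hs

end LieSpan

theorem eq_zero_of_mem_degreeSum {K L : Type*} [Field K] [CharZero K] [LieRing L] [LieAlgebra K L]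
    {d x : L} {S : Set ℤ} {n : ℤ} (hn : n ∉ S) (hx : x ∈ degreeSum K d S)
    (hx' : ⁅d, x⁆ = (n : K) • x) : x = 0 := by
  have disjoint := ((End.eigenspaces_iSupIndep (ad K L d)).comp
    (Int.cast_injective (α := K))).disjoint_biSup hn
  have degreeSum_le : degreeSum K d S ≤ ⨆ m ∈ S, End.eigenspace (ad K L d) (m : K) :=
    Submodule.span_le.2 fun z ⟨m, hm, hz⟩ =>
      Submodule.mem_iSup_of_mem m <| Submodule.mem_iSup_of_mem hm <| End.mem_eigenspace_iff.2 hz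
  exact Submodule.disjoint_def.1 disjoint x (End.mem_eigenspace_iff.2 hx') (degreeSum_le hx)

/-! ### Generators of Kac–Moody type -/

namespace Realization

variable {I : Type*} [Fintype I] {A : Matrix I I ℤ} {𝔥 : Type*} [AddCommGroup 𝔥] [Module ℂ 𝔥]

theorem exists_simpleRoot_apply_eq (R : Realization A 𝔥) (c : I → ℂ) :
    ∃ δ : 𝔥, ∀ i, R.simpleRoot i δ = c i := by
  have indep : LinearIndependent ℂ fun i x => R.simpleRoot i x :=
    R.linearIndependent_simpleRoot.map' (LinearMap.ltoFun ℂ 𝔥 ℂ ℂ)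
      (LinearMap.ker_eq_bot.2 DFunLike.coe_injective)
  have range_eq_top : LinearMap.range (LinearMap.pi R.simpleRoot) = ⊤ := by
    rw [← span_flip_eq_top_iff_linearIndependent.2 indep]
    exact (Submodule.span_eq _).symm
  obtain ⟨δ, hδ⟩ := LinearMap.range_eq_top.1 range_eq_top c
  exact ⟨δ, congrFun hδ⟩

theorem simpleRoot_simpleCoroot_self (R : Realization A 𝔥) (hA : IsGCM A) (i : I) :
    R.simpleRoot i (R.simpleCoroot i) = 2 := by
  rw [R.simpleRoot_simpleCoroot, hA.diag, Int.cast_ofNat]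

/-- Elements `Eᵢ`, `Fᵢ` and a linear map `H` from `𝔥` that satisfy the defining relations of
`𝔤̃(A)` and generate the Lie algebra `L`. Working with all such `L` treats `𝔤̃(A)` and `𝔤(A)` at the
same time and provides the symmetry `opposite`. -/
structure ChevalleyGenerators (R : Realization A 𝔥) (L : Type*) [LieRing L] [LieAlgebra ℂ L] where
  H : 𝔥 →ₗ[ℂ] L
  E : I → L
  F : I → L
  lie_H_H : ∀ x y, ⁅H x, H y⁆ = 0
  lie_E_F_same : ∀ i, ⁅E i, F i⁆ = H (R.simpleCoroot i)
  lie_E_F_ne : ∀ i j, i ≠ j → ⁅E i, F j⁆ = 0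
  lie_H_E : ∀ x i, ⁅H x, E i⁆ = R.simpleRoot i x • E i
  lie_H_F : ∀ x i, ⁅H x, F i⁆ = -(R.simpleRoot i x • F i)
  generates : LieSubalgebra.lieSpan ℂ L (Set.range E ∪ Set.range F ∪ Set.range H) = ⊤

namespace ChevalleyGenerators

variable {R : Realization A 𝔥} {L : Type*} [LieRing L] [LieAlgebra ℂ L]

/-- The generators with the roles of `Eᵢ` and `Fᵢ` exchanged. -/
def opposite (g : R.ChevalleyGenerators L) : R.ChevalleyGenerators L where
  H := -g.H
  E := g.F
  F := g.E
  lie_H_H x y := by simp [g.lie_H_H]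
  lie_E_F_same i := by rw [← lie_skew, g.lie_E_F_same, LinearMap.neg_apply]
  lie_E_F_ne i j hij := by rw [← lie_skew, g.lie_E_F_ne j i hij.symm, neg_zero]
  lie_H_E x i := by simp [g.lie_H_F]
  lie_H_F x i := by simp [g.lie_H_E]
  generates := by
    have range_neg : Set.range ⇑(-g.H) = Set.range g.H := by
      ext z
      exact (Equiv.neg 𝔥).exists_congr fun x => by simp
    rw [range_neg, Set.union_comm (Set.range g.F), g.generates]

/-- The images of the generators under a surjective homomorphism. -/
def map (g : R.ChevalleyGenerators L) {L' : Type*} [LieRing L'] [LieAlgebra ℂ L']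
    (π : L →ₗ⁅ℂ⁆ L') (hπ : Function.Surjective π) : R.ChevalleyGenerators L' where
  H := (π : L →ₗ[ℂ] L') ∘ₗ g.H
  E i := π (g.E i)
  F i := π (g.F i)
  lie_H_H x y := by simp [← LieHom.map_lie, g.lie_H_H]
  lie_E_F_same i := by simp [← LieHom.map_lie, g.lie_E_F_same]
  lie_E_F_ne i j hij := by simp [← LieHom.map_lie, g.lie_E_F_ne i j hij]
  lie_H_E x i := by simp [← LieHom.map_lie, g.lie_H_E]
  lie_H_F x i := by simp [← LieHom.map_lie, g.lie_H_F]
  generates := by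
    rw [← (LieHom.range_eq_top π).2 hπ, LieHom.range_eq_map, ← g.generates,
      LieSubalgebra.map_lieSpan, Set.image_union, Set.image_union, ← Set.range_comp,
      ← Set.range_comp, ← Set.range_comp]
    rfl

variable (g : R.ChevalleyGenerators L)

theorem lie_mem_of_stable {M : Type*} [AddCommGroup M] [Module ℂ M] [LieRingModule L M]
    [LieModule ℂ L M] {U : Submodule ℂ M} (hE : ∀ i, ∀ u ∈ U, ⁅g.E i, u⁆ ∈ U)
    (hF : ∀ i, ∀ u ∈ U, ⁅g.F i, u⁆ ∈ U) (hH : ∀ x, ∀ u ∈ U, ⁅g.H x, u⁆ ∈ U) (x : L) {u : M}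
    (hu : u ∈ U) : ⁅x, u⁆ ∈ U := by
  refine lie_mem_of_mem_lieSpan_left (s := Set.range g.E ∪ Set.range g.F ∪ Set.range g.H) ?_
    (g.generates ▸ LieSubalgebra.mem_top x) hu
  rintro _ ((⟨i, rfl⟩ | ⟨i, rfl⟩) | ⟨x, rfl⟩)
  exacts [hE i, hF i, hH x]

/-- The simultaneous eigenspace `{y | [H x, y] = μ(x) y for all x ∈ 𝔥}`. -/
def weightSpace (μ : Dual ℂ 𝔥) : Submodule ℂ L :=
  ⨅ x, End.eigenspace (ad ℂ L (g.H x)) (μ x)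

variable {g}

theorem mem_weightSpace {μ : Dual ℂ 𝔥} {y : L} :
    y ∈ g.weightSpace μ ↔ ∀ x, ⁅g.H x, y⁆ = μ x • y := by
  simp only [weightSpace, Submodule.mem_iInf, End.mem_eigenspace_iff, ad_apply]

theorem lie_mem_weightSpace {μ ν : Dual ℂ 𝔥} {y z : L} (hy : y ∈ g.weightSpace μ)
    (hz : z ∈ g.weightSpace ν) : ⁅y, z⁆ ∈ g.weightSpace (μ + ν) := by
  rw [mem_weightSpace] at *
  intro x
  rw [leibniz_lie, hy, hz, smul_lie, lie_smul, LinearMap.add_apply, add_smul]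

theorem ad_pow_mem_weightSpace {μ ν : Dual ℂ 𝔥} {y z : L} (hy : y ∈ g.weightSpace μ)
    (hz : z ∈ g.weightSpace ν) (n : ℕ) : (ad ℂ L y ^ n) z ∈ g.weightSpace (ν + n • μ) := by
  induction n with
  | zero => simpa using hz
  | succ n ih =>
    rw [pow_succ', End.mul_apply, ad_apply, succ_nsmul', add_left_comm]
    exact lie_mem_weightSpace hy ih

variable (g)

theorem E_mem_weightSpace (i : I) : g.E i ∈ g.weightSpace (R.simpleRoot i) :=
  mem_weightSpace.2 fun x => g.lie_H_E x i

theorem F_mem_weightSpace (i : I) : g.F i ∈ g.weightSpace (-R.simpleRoot i) :=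
  mem_weightSpace.2 fun x => by rw [g.lie_H_F, LinearMap.neg_apply, neg_smul]

theorem isSl2Triple (hA : IsGCM A) {i : I} (hi : g.H (R.simpleCoroot i) ≠ 0) :
    IsSl2Triple (g.H (R.simpleCoroot i)) (g.E i) (g.F i) where
  h_ne_zero := hi
  lie_e_f := g.lie_E_F_same i
  lie_h_e_nsmul := by
    rw [g.lie_H_E, R.simpleRoot_simpleCoroot_self hA, ofNat_smul_eq_nsmul]
  lie_h_f_nsmul := by
    rw [g.lie_H_F, R.simpleRoot_simpleCoroot_self hA, ofNat_smul_eq_nsmul]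

theorem F_eq_zero_of_H_simpleCoroot_eq_zero (hA : IsGCM A) {i : I}
    (hi : g.H (R.simpleCoroot i) = 0) : g.F i = 0 := by
  have h := g.lie_H_F (R.simpleCoroot i) i
  rw [hi, zero_lie, R.simpleRoot_simpleCoroot_self hA] at h
  simpa using h

/-! ### Singular vectors and the Serre relations -/

/-- The element `[F_{i₁}, [F_{i₂}, … , [F_{iₙ}, y]]]` for the list `i₁, …, iₙ`. -/
def lower (y : L) (l : List I) : L :=
  l.foldr (fun i z => ⁅g.F i, z⁆) y

variable {g}

theorem lower_mem_weightSpace {y : L} {μ : Dual ℂ 𝔥} (hy : y ∈ g.weightSpace μ) (l : List I) :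
    g.lower y l ∈ g.weightSpace (μ - (l.map R.simpleRoot).sum) := by
  induction l with
  | nil => rwa [List.map_nil, List.sum_nil, sub_zero]
  | cons i l ih =>
    rw [List.map_cons, List.sum_cons, ← sub_sub, sub_right_comm, sub_eq_neg_add]
    exact lie_mem_weightSpace (g.F_mem_weightSpace i) ih

theorem lie_mem_span_range_lower {y a u : L}
    (ha : ∀ l, ⁅a, g.lower y l⁆ ∈ Submodule.span ℂ (Set.range (g.lower y)))
    (hu : u ∈ Submodule.span ℂ (Set.range (g.lower y))) :
    ⁅a, u⁆ ∈ Submodule.span ℂ (Set.range (g.lower y)) :=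
  (Submodule.map_span_le (ad ℂ L a) _ _).2 (Set.forall_mem_range.2 ha) (Submodule.mem_map_of_mem hu)

theorem lie_H_lower_mem_span {y : L} {μ : Dual ℂ 𝔥} (hy : y ∈ g.weightSpace μ) (x : 𝔥)
    (l : List I) : ⁅g.H x, g.lower y l⁆ ∈ Submodule.span ℂ (Set.range (g.lower y)) := by
  rw [mem_weightSpace.1 (lower_mem_weightSpace hy l)]
  exact Submodule.smul_mem _ _ (Submodule.subset_span ⟨l, rfl⟩)

theorem lie_F_lower_mem_span (y : L) (i : I) (l : List I) :
    ⁅g.F i, g.lower y l⁆ ∈ Submodule.span ℂ (Set.range (g.lower y)) :=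
  Submodule.subset_span ⟨i :: l, rfl⟩

theorem lie_E_lower_mem_span {y : L} {μ : Dual ℂ 𝔥} (hy : y ∈ g.weightSpace μ)
    (hE : ∀ k, ⁅g.E k, y⁆ = 0) (k : I) (l : List I) :
    ⁅g.E k, g.lower y l⁆ ∈ Submodule.span ℂ (Set.range (g.lower y)) := by
  induction l with
  | nil => exact hE k ▸ zero_mem _
  | cons j l ih =>
    change ⁅g.E k, ⁅g.F j, g.lower y l⁆⁆ ∈ _
    rw [leibniz_lie]
    refine add_mem ?_ (lie_mem_span_range_lower (lie_F_lower_mem_span y j) ih)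
    obtain rfl | hkj := eq_or_ne k j
    · rw [g.lie_E_F_same]
      exact lie_H_lower_mem_span hy _ l
    · rw [g.lie_E_F_ne k j hkj, zero_lie]
      exact zero_mem _

theorem span_range_lower_le_degreeSum {y : L} {μ : Dual ℂ 𝔥} (hy : y ∈ g.weightSpace μ) {δ : 𝔥}
    (hδ : ∀ i, R.simpleRoot i δ = 1) {n : ℤ} (hμ : μ δ = n) :
    Submodule.span ℂ (Set.range (g.lower y)) ≤ degreeSum ℂ (g.H δ) (Set.Iic n) := by
  rw [Submodule.span_le, Set.range_subset_iff]
  intro l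
  refine mem_degreeSum (n := n - l.length) (by simp) ?_
  have sum_apply : (l.map R.simpleRoot).sum δ = l.length := by
    induction l with
    | nil => simp
    | cons i l ih => simp [ih, hδ, add_comm]
  rw [mem_weightSpace.1 (lower_mem_weightSpace hy l), LinearMap.sub_apply, hμ, sum_apply]
  push_cast
  rfl

theorem exists_lieIdeal_of_singular {y : L} {μ : Dual ℂ 𝔥} (hy : y ∈ g.weightSpace μ)
    (hE : ∀ k, ⁅g.E k, y⁆ = 0) {δ : 𝔥} (hδ : ∀ i, R.simpleRoot i δ = 1) {n : ℤ} (hn : n < 0)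
    (hμ : μ δ = n) :
    ∃ J : LieIdeal ℂ L, y ∈ J ∧ J.toSubmodule ⊓ LinearMap.range g.H = ⊥ := by
  refine ⟨{ Submodule.span ℂ (Set.range (g.lower y)) with
    lie_mem := fun {x _} hu => g.lie_mem_of_stable
      (fun k _ => lie_mem_span_range_lower (lie_E_lower_mem_span hy hE k))
      (fun k _ => lie_mem_span_range_lower (lie_F_lower_mem_span y k))
      (fun h _ => lie_mem_span_range_lower (lie_H_lower_mem_span hy h)) x hu },
    Submodule.subset_span ⟨[], rfl⟩, ?_⟩
  rw [Submodule.eq_bot_iff]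
  rintro _ ⟨hx, ⟨x, rfl⟩⟩
  exact eq_zero_of_mem_degreeSum (n := 0) (by simpa using hn)
    (span_range_lower_le_degreeSum hy hδ hμ hx) (by simp [g.lie_H_H])

variable (g)

theorem ad_F_pow_F_mem_weightSpace (i j : I) (n : ℕ) :
    (ad ℂ L (g.F i) ^ n) (g.F j) ∈ g.weightSpace (-R.simpleRoot j + n • -R.simpleRoot i) :=
  ad_pow_mem_weightSpace (g.F_mem_weightSpace i) (g.F_mem_weightSpace j) n

theorem lie_E_serre_same (hA : IsGCM A) {i j : I} (hij : i ≠ j) :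
    ⁅g.E i, (ad ℂ L (g.F i) ^ ((-A i j).toNat + 1)) (g.F j)⁆ = 0 := by
  by_cases hi : g.H (R.simpleCoroot i) = 0
  · simp [pow_succ', g.F_eq_zero_of_H_simpleCoroot_eq_zero hA hi]
  have hcast : (((-A i j).toNat : ℕ) : ℂ) = -(A i j : ℂ) := by
    exact_mod_cast Int.toNat_of_nonneg (neg_nonneg.2 (hA.nonpos i j hij))
  have hweight : ⁅g.H (R.simpleCoroot i), g.F j⁆ = (-(A i j : ℂ)) • g.F j := by
    rw [g.lie_H_F, R.simpleRoot_simpleCoroot, neg_smul]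
  have hEF : ⁅g.E i, ⁅g.F i, g.F j⁆⁆ = (-(A i j : ℂ)) • g.F j := by
    rw [leibniz_lie, g.lie_E_F_same, g.lie_E_F_ne i j hij, lie_zero, add_zero, hweight]
  refine (Sl2Rep.lie_e_pow_succ_f (g.isSl2Triple hA hi) hweight (-A i j).toNat).trans ?_
  rw [hEF, ← sub_smul, hcast]
  simp

theorem lie_E_ad_F_pow {i k : I} (hki : k ≠ i) (n : ℕ) (z : L) :
    ⁅g.E k, (ad ℂ L (g.F i) ^ n) z⁆ = (ad ℂ L (g.F i) ^ n) ⁅g.E k, z⁆ := by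
  have commute_ad : Commute (ad ℂ L (g.E k)) (ad ℂ L (g.F i)) := LinearMap.ext fun y => by
    change ⁅g.E k, ⁅g.F i, y⁆⁆ = ⁅g.F i, ⁅g.E k, y⁆⁆
    rw [leibniz_lie, g.lie_E_F_ne k i hki, zero_lie, zero_add]
  exact LinearMap.congr_fun (commute_ad.pow_right n).eq z

theorem lie_E_serre_of_ne (hA : IsGCM A) {i j k : I} (hij : i ≠ j) (hki : k ≠ i) :
    ⁅g.E k, (ad ℂ L (g.F i) ^ ((-A i j).toNat + 1)) (g.F j)⁆ = 0 := by
  rw [g.lie_E_ad_F_pow hki]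
  obtain rfl | hkj := eq_or_ne k j
  · rw [g.lie_E_F_same, pow_succ, End.mul_apply, ad_apply, ← lie_skew, g.lie_H_F,
      R.simpleRoot_simpleCoroot, neg_neg]
    by_cases h0 : A i k = 0
    · simp [hA.zero_symm i k h0]
    · have hneg := lt_of_le_of_ne (hA.nonpos i k hij) h0
      obtain ⟨n, hn⟩ : ∃ n, (-A i k).toNat = n + 1 := ⟨(-A i k).toNat - 1, by lia⟩
      rw [hn, pow_succ, End.mul_apply, ad_apply, lie_smul, lie_self, smul_zero, map_zero]
  · rw [g.lie_E_F_ne k j hkj, map_zero]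

theorem exists_lieIdeal_serre (hA : IsGCM A) {i j : I} (hij : i ≠ j) :
    ∃ J : LieIdeal ℂ L, (ad ℂ L (g.F i) ^ ((-A i j).toNat + 1)) (g.F j) ∈ J ∧
      J.toSubmodule ⊓ LinearMap.range g.H = ⊥ := by
  obtain ⟨δ, hδ⟩ := R.exists_simpleRoot_apply_eq fun _ => 1
  have singular (k : I) : ⁅g.E k, (ad ℂ L (g.F i) ^ ((-A i j).toNat + 1)) (g.F j)⁆ = 0 := by
    obtain rfl | hki := eq_or_ne k i
    · exact g.lie_E_serre_same hA hij
    · exact g.lie_E_serre_of_ne hA hij hki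
  refine exists_lieIdeal_of_singular (g.ad_F_pow_F_mem_weightSpace i j _) singular hδ
    (n := -1 - ((-A i j).toNat + 1 : ℕ)) (by lia) ?_
  simp only [LinearMap.add_apply, LinearMap.neg_apply, LinearMap.smul_apply, hδ, nsmul_eq_mul]
  push_cast
  ring

/-! ### Triangular decomposition -/

/-- The subalgebra generated by the `Eᵢ`. -/
def positive : LieSubalgebra ℂ L := LieSubalgebra.lieSpan ℂ L (Set.range g.E)

theorem E_mem_positive (i : I) : g.E i ∈ g.positive :=
  LieSubalgebra.subset_lieSpan ⟨i, rfl⟩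

variable {g}

theorem lie_H_mem_positive (h : 𝔥) {x : L} (hx : x ∈ g.positive) : ⁅g.H h, x⁆ ∈ g.positive := by
  refine lie_mem_of_mem_lieSpan_right (V := g.positive.toSubmodule)
    (fun a ha v hv => g.positive.lie_mem (LieSubalgebra.subset_lieSpan ha) hv) ?_ hx
  rintro _ ⟨i, rfl⟩
  rw [g.lie_H_E]
  exact g.positive.smul_mem _ (g.E_mem_positive i)

theorem lie_F_mem_range_H_sup_positive (j : I) {x : L} (hx : x ∈ g.positive) :
    ⁅g.F j, x⁆ ∈ LinearMap.range g.H ⊔ g.positive.toSubmodule := by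
  refine lie_mem_of_mem_lieSpan_right (Set.forall_mem_range.2 fun i v hv => ?_)
    (Set.forall_mem_range.2 fun i => ?_) hx
  · obtain ⟨_, ⟨h, rfl⟩, b, hb, rfl⟩ := Submodule.mem_sup.1 hv
    refine Submodule.mem_sup_right ?_
    rw [lie_add, ← lie_skew, g.lie_H_E]
    exact add_mem (neg_mem (g.positive.smul_mem _ (g.E_mem_positive i)))
      (g.positive.lie_mem (g.E_mem_positive i) hb)
  · refine Submodule.mem_sup_left ?_
    rw [← lie_skew]
    obtain rfl | hij := eq_or_ne i j
    · rw [g.lie_E_F_same]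
      exact neg_mem (LinearMap.mem_range_self _ _)
    · rw [g.lie_E_F_ne i j hij, neg_zero]
      exact zero_mem _

variable (g)

/-- The sum of the two triangular parts and `𝔥`. -/
def triangular : Submodule ℂ L :=
  LinearMap.range g.H ⊔ g.positive.toSubmodule ⊔ g.opposite.positive.toSubmodule

theorem triangular_opposite : g.opposite.triangular = g.triangular := by
  have range_opposite : LinearMap.range g.opposite.H = LinearMap.range g.H :=
    LinearMap.range_neg g.H
  rw [triangular, triangular, range_opposite, sup_right_comm]
  rfl

variable {g}

theorem lie_F_mem_triangular (j : I) {x : L} (hx : x ∈ g.triangular) :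
    ⁅g.F j, x⁆ ∈ g.triangular := by
  have hF : g.F j ∈ g.opposite.positive := g.opposite.E_mem_positive j
  obtain ⟨a, ha, c, hc, rfl⟩ := Submodule.mem_sup.1 hx
  obtain ⟨_, ⟨h, rfl⟩, b, hb, rfl⟩ := Submodule.mem_sup.1 ha
  rw [lie_add, lie_add]
  refine add_mem (add_mem ?_ (Submodule.mem_sup_left (lie_F_mem_range_H_sup_positive j hb)))
    (Submodule.mem_sup_right (g.opposite.positive.lie_mem hF hc))
  rw [← lie_skew, g.lie_H_F, neg_neg]
  exact Submodule.mem_sup_right (g.opposite.positive.smul_mem _ hF)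

theorem lie_E_mem_triangular (i : I) {x : L} (hx : x ∈ g.triangular) :
    ⁅g.E i, x⁆ ∈ g.triangular := by
  rw [← triangular_opposite] at hx ⊢
  exact lie_F_mem_triangular i hx

theorem lie_H_mem_triangular (h : 𝔥) {x : L} (hx : x ∈ g.triangular) :
    ⁅g.H h, x⁆ ∈ g.triangular := by
  obtain ⟨a, ha, c, hc, rfl⟩ := Submodule.mem_sup.1 hx
  obtain ⟨_, ⟨h', rfl⟩, b, hb, rfl⟩ := Submodule.mem_sup.1 ha
  have hc' : ⁅g.H h, c⁆ ∈ g.opposite.positive := by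
    simpa [opposite] using lie_H_mem_positive (-h) hc
  rw [lie_add, lie_add, g.lie_H_H, zero_add]
  exact add_mem (Submodule.mem_sup_left (Submodule.mem_sup_right (lie_H_mem_positive h hb)))
    (Submodule.mem_sup_right hc')

theorem triangular_eq_top : g.triangular = ⊤ := by
  let T : LieSubalgebra ℂ L :=
    { g.triangular with
      lie_mem' := fun {a _} _ hb => g.lie_mem_of_stable (fun i _ => lie_E_mem_triangular i)
        (fun i _ => lie_F_mem_triangular i) (fun h _ => lie_H_mem_triangular h) a hb }
  have generators_subset : Set.range g.E ∪ Set.range g.F ∪ Set.range g.H ⊆ T := by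
    rintro _ ((⟨i, rfl⟩ | ⟨i, rfl⟩) | ⟨x, rfl⟩)
    · exact Submodule.mem_sup_left (Submodule.mem_sup_right (g.E_mem_positive i))
    · exact Submodule.mem_sup_right (g.opposite.E_mem_positive i)
    · exact Submodule.mem_sup_left (Submodule.mem_sup_left (LinearMap.mem_range_self _ x))
  exact eq_top_iff.2 fun x _ =>
    LieSubalgebra.lieSpan_le.2 generators_subset (g.generates ▸ LieSubalgebra.mem_top x)

/-! ### The weight space of a simple root -/

theorem positive_le_span_E_sup_degreeSum {i : I} {δ : 𝔥} (hi : R.simpleRoot i δ = 1)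
    (hne : ∀ j, j ≠ i → R.simpleRoot j δ = 2) :
    g.positive.toSubmodule ≤ Submodule.span ℂ {g.E i} ⊔ degreeSum ℂ (g.H δ) (Set.Ici 2) := by
  have span_sup_le : Submodule.span ℂ {g.E i} ⊔ degreeSum ℂ (g.H δ) (Set.Ici 2) ≤
      degreeSum ℂ (g.H δ) (Set.Ici 1) := by
    refine sup_le ?_ (degreeSum_mono (Set.Ici_subset_Ici.2 one_le_two))
    rw [Submodule.span_singleton_le_iff_mem]
    exact mem_degreeSum (n := 1) Set.self_mem_Ici (by rw [g.lie_H_E, hi, Int.cast_one])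
  refine LieSubalgebra.lieSpan_le (K :=
    { Submodule.span ℂ {g.E i} ⊔ degreeSum ℂ (g.H δ) (Set.Ici 2) with
      lie_mem' := fun hx hy => Submodule.mem_sup_right <|
        lie_mem_degreeSum (fun m hm n hn => add_le_add (a := (1 : ℤ)) hm hn)
          (span_sup_le hx) (span_sup_le hy) }).2 (Set.range_subset_iff.2 fun j => ?_)
  obtain rfl | hj := eq_or_ne j i
  · exact Submodule.mem_sup_left (Submodule.mem_span_singleton_self _)
  · exact Submodule.mem_sup_right
      (mem_degreeSum (n := 2) Set.self_mem_Ici (by rw [g.lie_H_E, hne j hj, Int.cast_ofNat]))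

theorem opposite_positive_le_degreeSum {δ : 𝔥} (hδ : ∀ j, ∃ n : ℕ, 0 < n ∧ R.simpleRoot j δ = n) :
    g.opposite.positive.toSubmodule ≤ degreeSum ℂ (g.H δ) (Set.Iio 0) := by
  refine lieSpan_le_degreeSum (fun m hm n hn => add_neg (Set.mem_Iio.1 hm) (Set.mem_Iio.1 hn))
    (Set.range_subset_iff.2 fun j => ?_)
  obtain ⟨n, hn, hj⟩ := hδ j
  refine mem_degreeSum (n := -n) (by simpa using hn) ?_
  change ⁅g.H δ, g.F j⁆ = ((-n : ℤ) : ℂ) • g.F j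
  rw [g.lie_H_F, hj, Int.cast_neg, Int.cast_natCast, neg_smul]

variable (g)

theorem weightSpace_simpleRoot_le_span_E (i : I) :
    g.weightSpace (R.simpleRoot i) ≤ Submodule.span ℂ {g.E i} := by
  classical
  obtain ⟨δ, hδ⟩ := R.exists_simpleRoot_apply_eq fun j => ((if j = i then 1 else 2 : ℕ) : ℂ)
  have hi : R.simpleRoot i δ = 1 := by simp [hδ]
  have positive_le := positive_le_span_E_sup_degreeSum (g := g) hi fun j hj => by simp [hδ, hj]
  have negative_le := opposite_positive_le_degreeSum (g := g) fun j =>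
    ⟨if j = i then 1 else 2, by split_ifs <;> norm_num, hδ j⟩
  have range_H_le : LinearMap.range g.H ≤ degreeSum ℂ (g.H δ) {0} := by
    rintro _ ⟨h, rfl⟩
    exact mem_degreeSum (n := 0) rfl (by simp [g.lie_H_H])
  have top_le : ⊤ ≤ Submodule.span ℂ {g.E i} ⊔ degreeSum ℂ (g.H δ) {1}ᶜ := by
    rw [← g.triangular_eq_top]
    refine sup_le (sup_le ((range_H_le.trans (degreeSum_mono ?_)).trans le_sup_right)
      (positive_le.trans (sup_le_sup_left (degreeSum_mono ?_) _)))
      ((negative_le.trans (degreeSum_mono ?_)).trans le_sup_right)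
    all_goals
      intro n hn
      simp only [Set.mem_singleton_iff, Set.mem_Ici, Set.mem_Iio, Set.mem_compl_iff] at hn ⊢
      lia
  intro x hx
  obtain ⟨a, ha, b, hb, rfl⟩ := Submodule.mem_sup.1 (top_le (Submodule.mem_top (x := x)))
  have ha' : ⁅g.H δ, a⁆ = a := by
    obtain ⟨c, rfl⟩ := Submodule.mem_span_singleton.1 ha
    rw [lie_smul, g.lie_H_E, hi, one_smul]
  have hb0 : b = 0 := by
    refine eq_zero_of_mem_degreeSum (n := 1) (by simp) hb ?_
    have hab := mem_weightSpace.1 hx δ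
    rw [lie_add, ha', hi, one_smul, add_right_inj] at hab
    rw [hab, Int.cast_one, one_smul]
  rwa [hb0, add_zero]

/-! ### Lifts of Weyl group elements -/

theorem isLocallyNilpotent_ad_E
    (serre : ∀ i j, i ≠ j → (ad ℂ L (g.E i) ^ ((-A i j).toNat + 1)) (g.E j) = 0) (i : I) :
    IsLocallyNilpotent (ad ℂ L (g.E i)) := by
  rw [IsLocallyNilpotent.ad_iff_engel_eq_top, eq_top_iff, ← g.generates, LieSubalgebra.lieSpan_le]
  have lie_lie_H (x : 𝔥) : ⁅g.E i, ⁅g.E i, g.H x⁆⁆ = 0 := by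
    rw [← lie_skew (g.E i) (g.H x), g.lie_H_E, lie_neg, lie_smul, lie_self, smul_zero, neg_zero]
  rintro _ ((⟨j, rfl⟩ | ⟨j, rfl⟩) | ⟨x, rfl⟩)
  · obtain rfl | hij := eq_or_ne i j
    · exact LieSubalgebra.self_mem_engel ℂ _
    · exact (LieSubalgebra.mem_engel_iff ℂ _ _).2 ⟨_, serre i j hij⟩
  · refine (LieSubalgebra.mem_engel_iff ℂ _ _).2 ⟨3, ?_⟩
    simp only [pow_succ, pow_zero, one_mul, End.mul_apply, ad_apply]
    obtain rfl | hij := eq_or_ne i j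
    · rw [g.lie_E_F_same, lie_lie_H]
    · rw [g.lie_E_F_ne i j hij, lie_zero, lie_zero]
  · exact (LieSubalgebra.mem_engel_iff ℂ _ _).2 ⟨2, by simpa [pow_succ] using lie_lie_H x⟩

theorem expAd_E_H {i : I} (hE : IsLocallyNilpotent (ad ℂ L (g.E i))) (x : 𝔥) :
    expAd (g.E i) hE (g.H x) = g.H x - R.simpleRoot i x • g.E i := by
  have hEH : ⁅g.E i, g.H x⁆ = -(R.simpleRoot i x • g.E i) := by rw [← lie_skew, g.lie_H_E]
  refine (hE.exp_apply_of_sq_apply_eq_zero ?_).trans ?_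
  · rw [ad_apply, ad_apply, hEH, lie_neg, lie_smul, lie_self, smul_zero, neg_zero]
  · rw [ad_apply, hEH, sub_eq_add_neg]

theorem expAd_E_E {i : I} (hE : IsLocallyNilpotent (ad ℂ L (g.E i))) :
    expAd (g.E i) hE (g.E i) = g.E i :=
  hE.exp_apply_of_apply_eq_zero (lie_self _)

theorem lie_neg_F_H (i : I) (x : 𝔥) : ⁅-g.F i, g.H x⁆ = -(R.simpleRoot i x • g.F i) := by
  rw [neg_lie, lie_skew, g.lie_H_F]

theorem expAd_neg_F_H {i : I} (hF : IsLocallyNilpotent (ad ℂ L (-g.F i))) (x : 𝔥) :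
    expAd (-g.F i) hF (g.H x) = g.H x - R.simpleRoot i x • g.F i := by
  refine (hF.exp_apply_of_sq_apply_eq_zero ?_).trans ?_
  · rw [ad_apply, ad_apply, g.lie_neg_F_H, ← smul_neg, lie_smul, lie_self, smul_zero]
  · rw [ad_apply, g.lie_neg_F_H, sub_eq_add_neg]

theorem expAd_neg_F_E (hA : IsGCM A) {i : I} (hF : IsLocallyNilpotent (ad ℂ L (-g.F i))) :
    expAd (-g.F i) hF (g.E i) = g.E i + g.H (R.simpleCoroot i) - g.F i := by
  have hFE : ⁅-g.F i, g.E i⁆ = g.H (R.simpleCoroot i) := by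
    rw [neg_lie, lie_skew, g.lie_E_F_same]
  refine (hF.exp_apply_of_cube_apply_eq_zero ?_).trans ?_
  · rw [ad_apply, ad_apply, ad_apply, hFE, g.lie_neg_F_H, ← smul_neg, lie_smul, lie_self,
      smul_zero]
  · rw [ad_apply, ad_apply, hFE, g.lie_neg_F_H, R.simpleRoot_simpleCoroot_self hA]
    module

theorem exists_lieEquiv_simpleReflection (hA : IsGCM A) {i : I}
    (hE : IsLocallyNilpotent (ad ℂ L (g.E i))) (hF : IsLocallyNilpotent (ad ℂ L (g.F i))) :
    ∃ ψ : L ≃ₗ⁅ℂ⁆ L, ∀ x, ψ (g.H x) = g.H (x - R.simpleRoot i x • R.simpleCoroot i) := by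
  have hF' : IsLocallyNilpotent (ad ℂ L (-g.F i)) := by simpa only [map_neg] using hF.neg
  refine ⟨((expAd (g.E i) hE).trans (expAd (-g.F i) hF')).trans (expAd (g.E i) hE), fun x => ?_⟩
  have root_reflection : R.simpleRoot i (x - R.simpleRoot i x • R.simpleCoroot i) =
      -R.simpleRoot i x := by
    rw [map_sub, map_smul, R.simpleRoot_simpleCoroot_self hA, smul_eq_mul]
    ring
  have expAd_F_expAd_E_H : expAd (-g.F i) hF' (expAd (g.E i) hE (g.H x)) =
      g.H (x - R.simpleRoot i x • R.simpleCoroot i) - R.simpleRoot i x • g.E i := by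
    rw [g.expAd_E_H, map_sub, map_smul, g.expAd_neg_F_H, g.expAd_neg_F_E hA, map_sub, map_smul]
    module
  rw [LieEquiv.trans_apply, LieEquiv.trans_apply, expAd_F_expAd_E_H, map_sub, map_smul,
    g.expAd_E_H, g.expAd_E_E, root_reflection]
  module

theorem exists_lieEquiv_weylGroup (hA : IsGCM A)
    (hE : ∀ i, IsLocallyNilpotent (ad ℂ L (g.E i)))
    (hF : ∀ i, IsLocallyNilpotent (ad ℂ L (g.F i))) {w : 𝔥 ≃ₗ[ℂ] 𝔥} (hw : w ∈ R.weylGroup) :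
    ∃ ψ : L ≃ₗ⁅ℂ⁆ L, ∀ x, ψ (g.H x) = g.H (w x) := by
  induction hw using Subgroup.closure_induction with
  | mem s hs =>
    obtain ⟨i, hs⟩ := hs
    simpa only [hs] using g.exists_lieEquiv_simpleReflection hA (hE i) (hF i)
  | one => exact ⟨LieEquiv.refl, fun x => rfl⟩
  | mul v w _ _ hv hw =>
    obtain ⟨φ, hφ⟩ := hv
    obtain ⟨ψ, hψ⟩ := hw
    exact ⟨ψ.trans φ, fun x => by rw [LieEquiv.trans_apply, hψ, hφ, LinearEquiv.mul_apply]⟩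
  | inv w _ hw =>
    obtain ⟨ψ, hψ⟩ := hw
    refine ⟨ψ.symm, fun x => ?_⟩
    have h := hψ (w⁻¹ x)
    rw [← LinearEquiv.mul_apply, mul_inv_cancel, LinearEquiv.coe_one, id_eq] at h
    rw [← h, LieEquiv.symm_apply_apply]

end ChevalleyGenerators

/-! ### The Kac–Moody algebra -/

section KacMoody

variable (R : Realization A 𝔥)

variable {R} in
theorem lieQuotientMk_relationIdeal_eq_zero {x : R.Free} (hx : R.Relator x) :
    lieQuotientMk R.relationIdeal x = 0 :=
  lieQuotientMk_eq_zero (LieSubmodule.subset_lieSpan hx)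

theorem range_free_generators : Set.range R.freeE ∪ Set.range R.freeF ∪ Set.range R.freeH =
    Set.range (FreeLieAlgebra.of ℂ : KMGenerator I 𝔥 → R.Free) := by
  refine Set.Subset.antisymm ?_ ?_
  · rintro _ ((⟨i, rfl⟩ | ⟨i, rfl⟩) | ⟨x, rfl⟩) <;> exact ⟨_, rfl⟩
  · rintro _ ⟨i | i | x, rfl⟩
    exacts [.inl (.inl ⟨i, rfl⟩), .inl (.inr ⟨i, rfl⟩), .inr ⟨x, rfl⟩]

/-- The generators of `𝔤̃(A)`. -/
noncomputable def tildeGenerators : R.ChevalleyGenerators R.Tilde where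
  H := R.tildeCartan
  E i := lieQuotientMk R.relationIdeal (R.freeE i)
  F i := lieQuotientMk R.relationIdeal (R.freeF i)
  lie_H_H x y := (LieHom.map_lie _ _ _).symm.trans <|
    lieQuotientMk_relationIdeal_eq_zero (Relator.hh x y)
  lie_E_F_same i := by
    have h := lieQuotientMk_relationIdeal_eq_zero (Relator.ef_same (R := R) i)
    rwa [map_sub, LieHom.map_lie, sub_eq_zero] at h
  lie_E_F_ne i j hij := (LieHom.map_lie _ _ _).symm.trans <|
    lieQuotientMk_relationIdeal_eq_zero (Relator.ef_ne i j hij)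
  lie_H_E x i := by
    have h := lieQuotientMk_relationIdeal_eq_zero (Relator.he (R := R) x i)
    rwa [map_sub, LieHom.map_lie, sub_eq_zero, map_smul] at h
  lie_H_F x i := by
    have h := lieQuotientMk_relationIdeal_eq_zero (Relator.hf (R := R) x i)
    rwa [map_add, LieHom.map_lie, map_smul, add_eq_zero_iff_eq_neg] at h
  generates := by
    rw [← (LieHom.range_eq_top _).2 (lieQuotientMk_surjective R.relationIdeal),
      LieHom.range_eq_map, ← lieSpan_range_freeLieAlgebra_of, ← range_free_generators,
      LieSubalgebra.map_lieSpan, Set.image_union, Set.image_union, ← Set.range_comp,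
      ← Set.range_comp, ← Set.range_comp]
    rfl

/-- The generators of `𝔤(A)`. -/
noncomputable def generators : R.ChevalleyGenerators R.KacMoodyAlgebra :=
  R.tildeGenerators.map (lieQuotientMk R.radical) (lieQuotientMk_surjective R.radical)

variable {R} in
theorem lieQuotientMk_radical_eq_zero {J : LieIdeal ℂ R.Tilde} {x : R.Tilde} (hx : x ∈ J)
    (hJ : J.toSubmodule ⊓ LinearMap.range R.tildeCartan = ⊥) : lieQuotientMk R.radical x = 0 :=
  lieQuotientMk_eq_zero ((le_sSup hJ : J ≤ R.radical) hx)

theorem isLocallyNilpotent_ad_generators_F (hA : IsGCM A) (i : I) :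
    IsLocallyNilpotent (ad ℂ R.KacMoodyAlgebra (R.generators.F i)) := by
  refine R.generators.opposite.isLocallyNilpotent_ad_E (fun i j hij => ?_) i
  obtain ⟨J, hJ, hJ'⟩ := R.tildeGenerators.exists_lieIdeal_serre hA hij
  exact (map_ad_pow _ _ _ _).symm.trans (lieQuotientMk_radical_eq_zero hJ hJ')

theorem isLocallyNilpotent_ad_generators_E (hA : IsGCM A) (i : I) :
    IsLocallyNilpotent (ad ℂ R.KacMoodyAlgebra (R.generators.E i)) := by
  refine R.generators.isLocallyNilpotent_ad_E (fun i j hij => ?_) i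
  obtain ⟨J, hJ, hJ'⟩ := R.tildeGenerators.opposite.exists_lieIdeal_serre hA hij
  have range_opposite : LinearMap.range R.tildeGenerators.opposite.H =
      LinearMap.range R.tildeCartan := LinearMap.range_neg _
  rw [range_opposite] at hJ'
  exact (map_ad_pow _ _ _ _).symm.trans (lieQuotientMk_radical_eq_zero hJ hJ')

theorem exists_lieEquiv_kacMoodyAlgebra (hA : IsGCM A) {w : 𝔥 ≃ₗ[ℂ] 𝔥} (hw : w ∈ R.weylGroup) :
    ∃ ψ : R.KacMoodyAlgebra ≃ₗ⁅ℂ⁆ R.KacMoodyAlgebra, ∀ x, ψ (R.cartan x) = R.cartan (w x) :=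
  R.generators.exists_lieEquiv_weylGroup hA (R.isLocallyNilpotent_ad_generators_E hA)
    (R.isLocallyNilpotent_ad_generators_F hA) hw

theorem weightSpace_generators (α : Dual ℂ 𝔥) : R.generators.weightSpace α = R.rootSpace α := by
  ext x
  exact ChevalleyGenerators.mem_weightSpace

end KacMoody

/-! ### Real roots -/

section RealRoots

variable {R : Realization A 𝔥} {α β : Dual ℂ 𝔥}

theorem ad_pow_mem_rootSpace {x y : R.KacMoodyAlgebra} (hx : x ∈ R.rootSpace α)
    (hy : y ∈ R.rootSpace β) (n : ℕ) :
    (ad ℂ R.KacMoodyAlgebra x ^ n) y ∈ R.rootSpace (β + n • α) := by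
  rw [← weightSpace_generators] at *
  exact ChevalleyGenerators.ad_pow_mem_weightSpace hx hy n

theorem map_mem_rootSpace_iff {ψ : R.KacMoodyAlgebra ≃ₗ⁅ℂ⁆ R.KacMoodyAlgebra} {w : 𝔥 ≃ₗ[ℂ] 𝔥}
    (hψ : ∀ x, ψ (R.cartan x) = R.cartan (w x)) {y : R.KacMoodyAlgebra} :
    ψ y ∈ R.rootSpace α ↔ y ∈ R.rootSpace (α ∘ₗ w.toLinearMap) := by
  change (∀ x, ⁅R.cartan x, ψ y⁆ = α x • ψ y) ↔ ∀ x, ⁅R.cartan x, y⁆ = α (w x) • y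
  rw [w.surjective.forall]
  refine forall_congr' fun x => ?_
  rw [← hψ, ← LieEquiv.map_lie, ← map_smul]
  exact ψ.injective.eq_iff

theorem comp_mem_roots (hA : IsGCM A) (hα : α ∈ R.roots) {w : 𝔥 ≃ₗ[ℂ] 𝔥} (hw : w ∈ R.weylGroup) :
    α ∘ₗ w.toLinearMap ∈ R.roots := by
  obtain ⟨ψ, hψ⟩ := R.exists_lieEquiv_kacMoodyAlgebra hA hw
  obtain ⟨y, hy, hy0⟩ := Submodule.exists_mem_ne_zero_of_ne_bot hα.2
  refine ⟨fun h0 => hα.1 ?_, (Submodule.ne_bot_iff _).2 ⟨ψ.symm y, ?_, ?_⟩⟩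
  · exact (LinearMap.cancel_right w.surjective).1 (h0.trans (LinearMap.zero_comp _).symm)
  · rwa [← map_mem_rootSpace_iff hψ, LieEquiv.apply_symm_apply]
  · exact EmbeddingLike.map_ne_zero_iff.2 hy0

theorem comp_mem_realRoots (hA : IsGCM A) (hα : α ∈ R.realRoots) {w : 𝔥 ≃ₗ[ℂ] 𝔥}
    (hw : w ∈ R.weylGroup) : α ∘ₗ w.toLinearMap ∈ R.realRoots := by
  obtain ⟨hα, ⟨v, i⟩, hv, rfl⟩ := hα
  refine ⟨comp_mem_roots hA hα hw, (w⁻¹ * v, i), mul_mem (inv_mem hw) hv, ?_⟩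
  rw [mul_inv_rev, inv_inv]
  rfl

theorem exists_simpleRoot_eq_comp (hα : α ∈ R.realRoots) :
    ∃ w ∈ R.weylGroup, ∃ i, R.simpleRoot i = α ∘ₗ w.toLinearMap ∧
      R.coroot α = w (R.simpleCoroot i) := by
  obtain ⟨hw, h⟩ := hα.2.choose_spec
  refine ⟨_, hw, _, LinearMap.ext fun x => ?_, dif_pos hα.2⟩
  rw [LinearMap.comp_apply, LinearEquiv.coe_coe, LinearMap.congr_fun h]
  exact congrArg _ (LinearEquiv.symm_apply_apply _ x).symm

theorem apply_coroot (hA : IsGCM A) (hα : α ∈ R.realRoots) : α (R.coroot α) = 2 := by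
  obtain ⟨w, -, i, h, hcoroot⟩ := exists_simpleRoot_eq_comp hα
  rw [hcoroot, ← R.simpleRoot_simpleCoroot_self hA i, h]
  rfl

theorem rootSpace_le_span_singleton (hA : IsGCM A) (hα : α ∈ R.realRoots) {x : R.KacMoodyAlgebra}
    (hx : x ∈ R.rootSpace α) (hx0 : x ≠ 0) : R.rootSpace α ≤ Submodule.span ℂ {x} := by
  obtain ⟨w, hw, i, hi, -⟩ := exists_simpleRoot_eq_comp hα
  obtain ⟨ψ, hψ⟩ := R.exists_lieEquiv_kacMoodyAlgebra hA hw
  have exists_smul {z} (hz : z ∈ R.rootSpace α) : ∃ c : ℂ, c • ψ (R.generators.E i) = z := by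
    rw [← ψ.apply_symm_apply z, map_mem_rootSpace_iff hψ, ← hi, ← weightSpace_generators] at hz
    obtain ⟨c, hc⟩ := Submodule.mem_span_singleton.1
      (R.generators.weightSpace_simpleRoot_le_span_E i hz)
    exact ⟨c, by rw [← map_smul, hc, ψ.apply_symm_apply]⟩
  obtain ⟨a, rfl⟩ := exists_smul hx
  intro z hz
  obtain ⟨b, rfl⟩ := exists_smul hz
  rw [Submodule.span_singleton_smul_eq (left_ne_zero_of_smul hx0).isUnit]
  exact Submodule.smul_mem _ b (Submodule.mem_span_singleton_self _)

theorem reflection_coroot_mem_weylGroup (hA : IsGCM A) (hα : α ∈ R.realRoots) :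
    Module.reflection (apply_coroot hA hα) ∈ R.weylGroup := by
  obtain ⟨w, hw, i, hi, hcoroot⟩ := exists_simpleRoot_eq_comp hα
  have simple_mem : Module.reflection (R.simpleRoot_simpleCoroot_self hA i) ∈ R.weylGroup :=
    Subgroup.subset_closure ⟨i, fun _ => Module.reflection_apply _ _⟩
  convert mul_mem (mul_mem hw simple_mem) (inv_mem hw)
  ext x
  have apply_inv : w (w⁻¹ x) = x := LinearEquiv.apply_symm_apply w x
  simp only [LinearEquiv.mul_apply, Module.reflection_apply, map_sub, map_smul, hi, hcoroot,
    LinearMap.comp_apply, LinearEquiv.coe_coe, apply_inv]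

theorem reflection_eq_comp_reflection (hA : IsGCM A) (hα : α ∈ R.realRoots) (β : Dual ℂ 𝔥) :
    R.reflection α β = β ∘ₗ (Module.reflection (apply_coroot hA hα)).toLinearMap := by
  ext x
  simp only [Realization.reflection, LinearMap.sub_apply, LinearMap.smul_apply, smul_eq_mul,
    LinearMap.comp_apply, LinearEquiv.coe_coe, Module.reflection_apply, map_sub, map_smul, mul_comm]

theorem reflection_mem_roots (hA : IsGCM A) (hα : α ∈ R.realRoots) (hβ : β ∈ R.roots) :
    R.reflection α β ∈ R.roots := by
  rw [reflection_eq_comp_reflection hA hα]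
  exact comp_mem_roots hA hβ (reflection_coroot_mem_weylGroup hA hα)

theorem reflection_mem_realRoots (hA : IsGCM A) (hα : α ∈ R.realRoots) (hβ : β ∈ R.realRoots) :
    R.reflection α β ∈ R.realRoots := by
  rw [reflection_eq_comp_reflection hA hα]
  exact comp_mem_realRoots hA hβ (reflection_coroot_mem_weylGroup hA hα)

theorem neg_mem_realRoots (hA : IsGCM A) (hα : α ∈ R.realRoots) : -α ∈ R.realRoots := by
  have reflection_self : R.reflection α α = -α := by
    rw [Realization.reflection, apply_coroot hA hα]
    module
  exact reflection_self ▸ reflection_mem_realRoots hA hα hα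

/-- An `𝔰𝔩₂`-triple in `𝔤_α`, `𝔤_{-α}` and `𝔥` whose nilpositive and nilnegative elements act
locally nilpotently. The element `u` is not required to be `R.coroot α`, which makes the symmetry
under `α ↦ -α` visible. -/
structure IsRootTriple (R : Realization A 𝔥) (α : Dual ℂ 𝔥) (u : 𝔥) (e f : R.KacMoodyAlgebra) :
    Prop where
  apply_eq_two : α u = 2
  isSl2Triple : IsSl2Triple (R.cartan u) e f
  e_mem : e ∈ R.rootSpace α
  f_mem : f ∈ R.rootSpace (-α)
  isLocallyNilpotent_e : IsLocallyNilpotent (ad ℂ R.KacMoodyAlgebra e)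
  isLocallyNilpotent_f : IsLocallyNilpotent (ad ℂ R.KacMoodyAlgebra f)

namespace IsRootTriple

variable {u : 𝔥} {e f : R.KacMoodyAlgebra}

theorem symm (t : R.IsRootTriple α u e f) : R.IsRootTriple (-α) (-u) f e where
  apply_eq_two := by rw [LinearMap.neg_apply, map_neg, neg_neg, t.apply_eq_two]
  isSl2Triple := by rw [map_neg]; exact t.isSl2Triple.symm
  e_mem := t.f_mem
  f_mem := by rw [neg_neg]; exact t.e_mem
  isLocallyNilpotent_e := t.isLocallyNilpotent_f
  isLocallyNilpotent_f := t.isLocallyNilpotent_e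

theorem map {w : 𝔥 ≃ₗ[ℂ] 𝔥} (t : R.IsRootTriple (α ∘ₗ w.toLinearMap) u e f)
    {ψ : R.KacMoodyAlgebra ≃ₗ⁅ℂ⁆ R.KacMoodyAlgebra}
    (hψ : ∀ x, ψ (R.cartan x) = R.cartan (w x)) : R.IsRootTriple α (w u) (ψ e) (ψ f) where
  apply_eq_two := t.apply_eq_two
  isSl2Triple := by
    rw [← hψ]
    exact
      { h_ne_zero := EmbeddingLike.map_ne_zero_iff.2 t.isSl2Triple.h_ne_zero
        lie_e_f := by rw [← LieEquiv.map_lie, t.isSl2Triple.lie_e_f]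
        lie_h_e_nsmul := by rw [← LieEquiv.map_lie, t.isSl2Triple.lie_h_e_nsmul, map_nsmul]
        lie_h_f_nsmul := by
          rw [← LieEquiv.map_lie, t.isSl2Triple.lie_h_f_nsmul, map_neg, map_nsmul] }
  e_mem := (map_mem_rootSpace_iff hψ).2 t.e_mem
  f_mem := (map_mem_rootSpace_iff hψ).2 t.f_mem
  isLocallyNilpotent_e := .ad_lieEquiv ψ t.isLocallyNilpotent_e
  isLocallyNilpotent_f := .ad_lieEquiv ψ t.isLocallyNilpotent_f

end IsRootTriple

theorem cartan_simpleCoroot_ne_zero (hA : IsGCM A) {i : I} (hi : R.simpleRoot i ∈ R.roots) :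
    R.cartan (R.simpleCoroot i) ≠ 0 := by
  intro h0
  have E_eq_zero : R.generators.E i = 0 :=
    R.generators.opposite.F_eq_zero_of_H_simpleCoroot_eq_zero hA (neg_eq_zero.2 h0)
  refine hi.2 (eq_bot_iff.2 ?_)
  rw [← weightSpace_generators]
  refine (R.generators.weightSpace_simpleRoot_le_span_E i).trans ?_
  rw [E_eq_zero, Submodule.span_zero_singleton]

theorem isRootTriple_simpleRoot (hA : IsGCM A) {i : I} (hi : R.simpleRoot i ∈ R.roots) :
    R.IsRootTriple (R.simpleRoot i) (R.simpleCoroot i) (R.generators.E i) (R.generators.F i) where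
  apply_eq_two := R.simpleRoot_simpleCoroot_self hA i
  isSl2Triple := R.generators.isSl2Triple hA (cartan_simpleCoroot_ne_zero hA hi)
  e_mem := by rw [← weightSpace_generators]; exact R.generators.E_mem_weightSpace i
  f_mem := by rw [← weightSpace_generators]; exact R.generators.F_mem_weightSpace i
  isLocallyNilpotent_e := R.isLocallyNilpotent_ad_generators_E hA i
  isLocallyNilpotent_f := R.isLocallyNilpotent_ad_generators_F hA i

theorem exists_isRootTriple (hA : IsGCM A) (hα : α ∈ R.realRoots) :
    ∃ e f, R.IsRootTriple α (R.coroot α) e f := by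
  obtain ⟨w, hw, i, hi, hcoroot⟩ := exists_simpleRoot_eq_comp hα
  obtain ⟨ψ, hψ⟩ := R.exists_lieEquiv_kacMoodyAlgebra hA hw
  have t := isRootTriple_simpleRoot hA (hi ▸ comp_mem_roots hA hα.1 hw)
  rw [hi] at t
  exact ⟨_, _, hcoroot ▸ t.map hψ⟩

end RealRoots

/-! ### Root strings in symmetric subalgebras -/

section RootStrings

variable {R : Realization A 𝔥} {α β : Dual ℂ 𝔥} {s : LieSubalgebra ℂ R.KacMoodyAlgebra}

theorem mem_rootsOf_of_mem (hα : α ∈ R.roots) {x : R.KacMoodyAlgebra} (hx : x ∈ R.rootSpace α)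
    (hxs : x ∈ s) (hx0 : x ≠ 0) : α ∈ R.rootsOf s :=
  ⟨hα, (Submodule.ne_bot_iff _).2 ⟨x, ⟨hx, hxs⟩, hx0⟩⟩

theorem rootSpace_le_of_mem_realRootsOf (hA : IsGCM A) (hα : α ∈ R.realRootsOf s) :
    R.rootSpace α ≤ s.toSubmodule := by
  obtain ⟨x, ⟨hx, hxs⟩, hx0⟩ := Submodule.exists_mem_ne_zero_of_ne_bot hα.2.2
  exact (rootSpace_le_span_singleton hA hα.1 hx hx0).trans
    ((Submodule.span_singleton_le_iff_mem _ _).2 hxs)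

theorem ad_pow_mem {x y : R.KacMoodyAlgebra} (hx : x ∈ s) (hy : y ∈ s) (n : ℕ) :
    (ad ℂ R.KacMoodyAlgebra x ^ n) y ∈ s := by
  induction n with
  | zero => exact hy
  | succ n ih =>
    rw [pow_succ', End.mul_apply]
    exact s.lie_mem hx ih

namespace IsRootTriple

variable {u : 𝔥} {e f : R.KacMoodyAlgebra}

theorem exists_apply_eq_intCast (t : R.IsRootTriple α u e f) (hβ : β ∈ R.roots) :
    ∃ m : ℤ, β u = m := by
  obtain ⟨y, hy, hy0⟩ := Submodule.exists_mem_ne_zero_of_ne_bot hβ.2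
  exact Sl2Rep.exists_intCast_eq_weight t.isSl2Triple t.isLocallyNilpotent_e
    t.isLocallyNilpotent_f hy0 (hy u)

theorem ad_pow_e_ne_zero (hA : IsGCM A) (t : R.IsRootTriple α u e f) (hβ : β ∈ R.realRoots)
    {k : ℕ} (hk : β + k • α ∈ R.roots) {x : R.KacMoodyAlgebra} (hx : x ∈ R.rootSpace β)
    (hx0 : x ≠ 0) : (ad ℂ R.KacMoodyAlgebra e ^ k) x ≠ 0 := by
  obtain ⟨m, hm⟩ := t.exists_apply_eq_intCast hβ.1
  rcases le_total (m + k) 0 with hmk | hmk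
  · exact Sl2Rep.pow_e_ne_zero_of_add_nonpos t.isSl2Triple t.isLocallyNilpotent_f hx0
      (hm ▸ hx u) hmk
  · obtain ⟨y, hy, hy0⟩ := Submodule.exists_mem_ne_zero_of_ne_bot hk.2
    have weight_y : (β + k • α) u = (m + 2 * k : ℤ) := by
      rw [LinearMap.add_apply, LinearMap.smul_apply, hm, t.apply_eq_two]
      push_cast
      ring
    have pow_f_mem : (ad ℂ R.KacMoodyAlgebra f ^ k) y ∈ R.rootSpace β := by
      simpa using ad_pow_mem_rootSpace t.f_mem hy k
    exact Sl2Rep.pow_e_ne_zero_of_pow_f_mem_span t.isSl2Triple t.isLocallyNilpotent_e hy0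
      (weight_y ▸ hy u) hmk (rootSpace_le_span_singleton hA hβ hx hx0 pow_f_mem)

theorem add_nsmul_mem_rootsOf (hA : IsGCM A) (t : R.IsRootTriple α u e f) (he : e ∈ s)
    (hβ : β ∈ R.realRootsOf s) {k : ℕ} (hk : β + k • α ∈ R.roots) : β + k • α ∈ R.rootsOf s := by
  obtain ⟨x, ⟨hx, hxs⟩, hx0⟩ := Submodule.exists_mem_ne_zero_of_ne_bot hβ.2.2
  exact mem_rootsOf_of_mem hk (ad_pow_mem_rootSpace t.e_mem hx k) (ad_pow_mem he hxs k)
    (t.ad_pow_e_ne_zero hA hβ.1 hk hx hx0)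

end IsRootTriple

theorem neg_mem_realRootsOf (hA : IsGCM A) (hsymm : R.IsSymmetric s) (hα : α ∈ R.realRootsOf s) :
    -α ∈ R.realRootsOf s :=
  ⟨neg_mem_realRoots hA hα.1, Eq.subset hsymm hα.2⟩

theorem rootString_subset_rootsOf (hA : IsGCM A) (hsymm : R.IsSymmetric s)
    (hα : α ∈ R.realRootsOf s) (hβ : β ∈ R.realRootsOf s) :
    R.rootString α β ⊆ R.rootsOf s := by
  rintro _ ⟨hk, k, rfl⟩
  obtain ⟨e, f, t⟩ := exists_isRootTriple hA hα.1
  have he : e ∈ s := rootSpace_le_of_mem_realRootsOf hA hα t.e_mem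
  have hf : f ∈ s := rootSpace_le_of_mem_realRootsOf hA (neg_mem_realRootsOf hA hsymm hα) t.f_mem
  obtain ⟨n, rfl | rfl⟩ := k.eq_nat_or_neg
  · rw [natCast_zsmul] at hk ⊢
    exact t.add_nsmul_mem_rootsOf hA he hβ hk
  · rw [neg_smul, natCast_zsmul, ← smul_neg] at hk ⊢
    exact t.symm.add_nsmul_mem_rootsOf hA hf hβ hk

theorem reflection_mem_rootString (hA : IsGCM A) (hα : α ∈ R.realRoots) (hβ : β ∈ R.roots) :
    R.reflection α β ∈ R.rootString α β := by
  obtain ⟨e, f, t⟩ := exists_isRootTriple hA hα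
  obtain ⟨m, hm⟩ := t.exists_apply_eq_intCast hβ
  refine ⟨reflection_mem_roots hA hα hβ, -m, ?_⟩
  rw [Realization.reflection, hm, Int.cast_smul_eq_zsmul, neg_smul, sub_eq_add_neg]

theorem add_mem_rootString (h : α + β ∈ R.roots) : α + β ∈ R.rootString α β :=
  ⟨h, 1, by rw [one_smul, add_comm]⟩

end RootStrings

end Realization

theorem mainTheorem4_general {I : Type*} [Fintype I] {𝔥 : Type*} [AddCommGroup 𝔥] [Module ℂ 𝔥]
    [FiniteDimensional ℂ 𝔥] (A : Matrix I I ℤ) (hA : IsGCM A) (R : Realization A 𝔥)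
    (s : LieSubalgebra ℂ R.KacMoodyAlgebra) (hsymm : R.IsSymmetric s) :
    (∀ α ∈ R.realRootsOf s, ∀ β ∈ R.realRootsOf s,
      (α + β ∈ R.roots → α + β ∈ R.rootsOf s) ∧
      R.reflection α β ∈ R.rootsOf s ∧
      R.rootString α β ⊆ R.rootsOf s) ∧
    ((R.realRootsOf s).Nonempty →
      R.IsRealClosed (R.realRootsOf s) ∧ R.IsSubrootSystem (R.realRootsOf s)) := by
  have string_subset {α β} (hα : α ∈ R.realRootsOf s) (hβ : β ∈ R.realRootsOf s) :
      R.rootString α β ⊆ R.rootsOf s :=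
    Realization.rootString_subset_rootsOf hA hsymm hα hβ
  have add_mem {α β} (hα : α ∈ R.realRootsOf s) (hβ : β ∈ R.realRootsOf s)
      (h : α + β ∈ R.roots) : α + β ∈ R.rootsOf s :=
    string_subset hα hβ (Realization.add_mem_rootString h)
  have reflection_mem {α β} (hα : α ∈ R.realRootsOf s) (hβ : β ∈ R.realRootsOf s) :
      R.reflection α β ∈ R.rootsOf s :=
    string_subset hα hβ (Realization.reflection_mem_rootString hA hα.1 hβ.1.1)
  exact ⟨fun α hα β hβ => ⟨add_mem hα hβ, reflection_mem hα hβ, string_subset hα hβ⟩, fun hne =>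
    ⟨⟨hne, fun _ hα => hα.1, fun _ hα _ hβ hαβ => ⟨hαβ, add_mem hα hβ hαβ.1⟩⟩,
      ⟨hne, fun _ hα => hα.1.1, fun _ hα _ hβ =>
        ⟨Realization.reflection_mem_realRoots hA hα.1.1 hβ.1, reflection_mem hα.1 hβ⟩⟩⟩⟩

theorem mainTheorem4 {I : Type*} [Fintype I] {𝔥 : Type*} [AddCommGroup 𝔥] [Module ℂ 𝔥]
    [FiniteDimensional ℂ 𝔥] (A : Matrix I I ℤ) (hA : IsGCM A) (hS : IsSymmetrizable A)
    (R : Realization A 𝔥) (s : LieSubalgebra ℂ R.KacMoodyAlgebra)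
    (hreg : R.IsRegular s) (hsymm : R.IsSymmetric s) :
    (∀ α ∈ R.realRootsOf s, ∀ β ∈ R.realRootsOf s,
      (α + β ∈ R.roots → α + β ∈ R.rootsOf s) ∧
      R.reflection α β ∈ R.rootsOf s ∧
      R.rootString α β ⊆ R.rootsOf s) ∧
    ((R.realRootsOf s).Nonempty →
      R.IsRealClosed (R.realRootsOf s) ∧ R.IsSubrootSystem (R.realRootsOf s)) :=
  mainTheorem4_general A hA R s hsymm
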